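/- Let $\mathbb K=\mathbb R$ or $\mathbb K=\mathbb C$. For an open set $\Omega\subset\mathbb R^n$ let $\mathcal G(\Omega)$ be the special Colombeau algebra: families $(u_\varepsilon)_{0<\varepsilon\le1}$ of smooth functions $u_\varepsilon:\Omega\to\mathbb K$ such that for every compact $K\subset\Omega$ and every multi-index $\alpha$ there is $p\ge0$ with $\sup_K|\partial^\alpha u_\varepsilon|=O(\varepsilon^{-p})$ as $\varepsilon\to0$ (moderate families), modulo those families for which $\sup_K|\partial^\alpha u_\varepsilon|=O(\varepsilon^{q})$ for all compact $K\subset\Omega$, all $\alpha$ and all $q\ge0$ (null families). Derivatives, restrictions to open subsets, the restriction of an element of $\mathcal G(\mathbb R^2)$ to $\{t=0\}$, and $f(u)$ for smooth $f$ that is polynomially bounded together with all its derivatives are defined on representatives. The support of $u\in\mathcal G(\Omega)$ is the complement in $\Omega$ of the largest open set on which $u$ is zero. Let $\mathcal G^\infty(\Omega)$ be the set of those elements of $\mathcal G(\Omega)$ that have a representative such that for every compact $K\subset\Omega$ there is $p\ge0$ with $\sup_K|\partial^\alpha u_\varepsilon|=O(\varepsilon^{-p})$ for all $\alpha$ (with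 $p$ independent of $\alpha$), and let $\mathcal L^1_{\mathcal G}(\Omega)$ be the set of those elements that have a representative converging in $L^1_{\rm loc}(\Omega)$ as $\varepsilon\to0$. The generalized numbers $\widetilde{\mathbb K}$ are the moderate families in $\mathbb K$ (that is, $|r_\varepsilon|=O(\varepsilon^{-p})$ for some $p\ge0$) modulo the negligible ones ($|r_\varepsilon|=O(\varepsilon^{q})$ for all $q\ge0$). **Proposition.** Let $f:\mathbb K\to\mathbb K$ be smooth (in the real sense if $\mathbb K=\mathbb C$) and globally Lipschitz, and let $f$ and all its derivatives be polynomially bounded. Let $u_i=r_i+s_i\in\mathcal G(\mathbb R)$, where $r_i\in\mathcal L^1_{\mathcal G}(\mathbb R)$, $s_i\in\mathcal G(\mathbb R)$ and $\operatorname{supp}s_i\subset\{0\}$, $i=0,1$, and let $u\in\mathcal G(\mathbb R^2)$ be the solution of $$\partial_t^2u-\partial_x^2u=f(u),\qquad u|_{t=0}=u_0,\qquad \partial_tu|_{t=0}=u_1 .$$ Let $M\in\widetilde{\mathbb K}$ be the class of $M_\varepsilon=\tfrac12\int_{-\infty}^{\infty}s_{1\varepsilon}(x)\,dx$, where $(s_{1\varepsilon})$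 is a representative of $s_1$ whose members all vanish outside a common compact interval ($M$ does not depend on the choice of such a representative). Suppose that either (a) $f$ is bounded and $M\approx m$ for some $m\in\mathbb K$, that is, $M_\varepsilon\to m$ as $\varepsilon\to0$; or (b) $f$ is bounded, $\lim_{|y|\to\infty}f(y)$ exists in $\mathbb K$, and $|M|\approx\infty$, that is, $|M_\varepsilon|\to\infty$ as $\varepsilon\to0$. Then $u\in\mathcal G^\infty(\mathbb R^2\setminus S)+\mathcal L^1_{\mathcal G}(\mathbb R^2)$, where $S=\{(x,t)\in\mathbb R^2:|x|=|t|\}$: there are $g,l\in\mathcal G(\mathbb R^2)$ with $u=g+l$ such that the restriction of $g$ to $\mathbb R^2\setminus S$ lies in $\mathcal G^\infty(\mathbb R^2\setminus S)$ and $l\in\mathcal L^1_{\mathcal G}(\mathbb R^2)$. -/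

import Mathlib

namespace Colombeau

open Filter Topology Set MeasureTheory TopologicalSpace
open scoped ContDiff

noncomputable section

section Families

variable {E F G H : Type*} [NormedAddCommGroup E] [NormedSpace ℝ E]
  [NormedAddCommGroup F] [NormedSpace ℝ F] [NormedAddCommGroup G] [NormedSpace ℝ G]
  [NormedAddCommGroup H] [NormedSpace ℝ H]

/-- `sup_{x ∈ K} |D^k u_ε (x)| = O(ε ^ a)` as `ε → 0+`. (The norm of the `k`-th Fréchet derivative
is, up to constants, the maximum of the partial derivatives of order `k`.) -/
def BoundOn (u : ℝ → E → F) (K : Set E) (k : ℕ) (a : ℝ) : Prop :=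
  ∃ C : ℝ, ∀ᶠ ε in 𝓝[>] (0 : ℝ), ∀ x ∈ K, ‖iteratedFDeriv ℝ k (u ε) x‖ ≤ C * ε ^ a

/-- A family `(u_ε)` with `u_ε` smooth on `Ω` for `0 < ε ≤ 1`. The values for other `ε`, and the
values off `Ω`, are irrelevant. -/
def IsSmoothFamily (Ω : Opens E) (u : ℝ → E → F) : Prop :=
  ∀ ε ∈ Ioc (0 : ℝ) 1, ContDiffOn ℝ ∞ (u ε) (Ω : Set E)

/-- Moderate families on `Ω`. -/
def IsModerate (Ω : Opens E) (u : ℝ → E → F) : Prop :=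
  IsSmoothFamily Ω u ∧
    ∀ K : Set E, IsCompact K → K ⊆ Ω → ∀ k : ℕ, ∃ p : ℝ, 0 ≤ p ∧ BoundOn u K k (-p)

/-- Null families on `Ω`. -/
def IsNull (Ω : Opens E) (u : ℝ → E → F) : Prop :=
  IsSmoothFamily Ω u ∧
    ∀ K : Set E, IsCompact K → K ⊆ Ω → ∀ k : ℕ, ∀ q : ℝ, 0 ≤ q → BoundOn u K k q

/-- Families all of whose derivatives have, locally, the same order of growth. -/
def IsRegularFamily (Ω : Opens E) (u : ℝ → E → F) : Prop :=
  IsSmoothFamily Ω u ∧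
    ∀ K : Set E, IsCompact K → K ⊆ Ω → ∃ p : ℝ, 0 ≤ p ∧ ∀ k : ℕ, BoundOn u K k (-p)

/-- Smooth functions which, together with all derivatives, have at most polynomial growth. -/
def SlowGrowth (f : F → G) : Prop :=
  ContDiff ℝ ∞ f ∧
    ∀ k : ℕ, ∃ (C : ℝ) (N : ℕ), ∀ y : F, ‖iteratedFDeriv ℝ k f y‖ ≤ C * (1 + ‖y‖) ^ N

theorem eventually_Ioo : ∀ᶠ ε in 𝓝[>] (0 : ℝ), ε ∈ Ioo (0 : ℝ) 1 :=
  Ioo_mem_nhdsGT one_pos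

theorem BoundOn.exists_nonneg {u : ℝ → E → F} {K : Set E} {k : ℕ} {a : ℝ} (h : BoundOn u K k a) :
    ∃ C : ℝ, 0 ≤ C ∧
      ∀ᶠ ε in 𝓝[>] (0 : ℝ), ∀ x ∈ K, ‖iteratedFDeriv ℝ k (u ε) x‖ ≤ C * ε ^ a := by
  obtain ⟨C, hC⟩ := h
  refine ⟨|C|, abs_nonneg C, ?_⟩
  filter_upwards [hC, eventually_Ioo] with ε h1 h2 x hx
  exact (h1 x hx).trans
    (mul_le_mul_of_nonneg_right (le_abs_self C) (Real.rpow_nonneg h2.1.le _))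

theorem BoundOn.mono {u : ℝ → E → F} {K : Set E} {k : ℕ} {a b : ℝ} (h : BoundOn u K k a)
    (hab : b ≤ a) : BoundOn u K k b := by
  obtain ⟨C, hC0, hC⟩ := h.exists_nonneg
  refine ⟨C, ?_⟩
  filter_upwards [hC, eventually_Ioo] with ε h1 h2 x hx
  exact (h1 x hx).trans
    (mul_le_mul_of_nonneg_left (Real.rpow_le_rpow_of_exponent_ge h2.1 h2.2.le hab) hC0)

theorem BoundOn.congr {u : ℝ → E → F} {v : ℝ → E → G} {K : Set E} {k l : ℕ} {a : ℝ}
    (h : BoundOn u K k a)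
    (huv : ∀ᶠ ε in 𝓝[>] (0 : ℝ), ∀ x ∈ K,
      ‖iteratedFDeriv ℝ l (v ε) x‖ ≤ ‖iteratedFDeriv ℝ k (u ε) x‖) :
    BoundOn v K l a := by
  obtain ⟨C, hC⟩ := h
  refine ⟨C, ?_⟩
  filter_upwards [hC, huv] with ε h1 h2 x hx
  exact (h2 x hx).trans (h1 x hx)

theorem BoundOn.add {Ω : Opens E} {u v : ℝ → E → F} (hu : IsSmoothFamily Ω u)
    (hv : IsSmoothFamily Ω v) {K : Set E} (hK : K ⊆ Ω) {k : ℕ} {a : ℝ}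
    (h1 : BoundOn u K k a) (h2 : BoundOn v K k a) : BoundOn (u + v) K k a := by
  obtain ⟨C, hC⟩ := h1
  obtain ⟨D, hD⟩ := h2
  refine ⟨C + D, ?_⟩
  filter_upwards [hC, hD, eventually_Ioo] with ε h1 h2 hε x hx
  have hε' : ε ∈ Ioc (0 : ℝ) 1 := ⟨hε.1, hε.2.le⟩
  have e1 : ContDiffAt ℝ k (u ε) x :=
    ((hu ε hε').contDiffAt (Ω.isOpen.mem_nhds (hK hx))).of_le (by exact_mod_cast le_top)
  have e2 : ContDiffAt ℝ k (v ε) x :=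
    ((hv ε hε').contDiffAt (Ω.isOpen.mem_nhds (hK hx))).of_le (by exact_mod_cast le_top)
  have : iteratedFDeriv ℝ k ((u + v) ε) x
      = iteratedFDeriv ℝ k (u ε) x + iteratedFDeriv ℝ k (v ε) x := iteratedFDeriv_add_apply e1 e2
  rw [this, add_mul]
  exact (norm_add_le _ _).trans (add_le_add (h1 x hx) (h2 x hx))

theorem BoundOn.bilin (B : F →L[ℝ] G →L[ℝ] H) {Ω : Opens E} {u : ℝ → E → F} {v : ℝ → E → G}
    (hu : IsSmoothFamily Ω u) (hv : IsSmoothFamily Ω v) {K : Set E} (hK : K ⊆ Ω) {k : ℕ} {a b : ℝ}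
    (h1 : ∀ i ≤ k, BoundOn u K i a) (h2 : ∀ i ≤ k, BoundOn v K i b) :
    BoundOn (fun ε x => B (u ε x) (v ε x)) K k (a + b) := by
  choose! C hC0 hC using fun i hi => (h1 i hi).exists_nonneg
  choose! D hD0 hD using fun i hi => (h2 i hi).exists_nonneg
  refine ⟨‖B‖ * ∑ i ∈ Finset.range (k + 1), (k.choose i : ℝ) * C i * D (k - i), ?_⟩
  have hC' : ∀ᶠ ε in 𝓝[>] (0 : ℝ), ∀ i ∈ Finset.range (k + 1), ∀ x ∈ K,
      ‖iteratedFDeriv ℝ i (u ε) x‖ ≤ C i * ε ^ a := by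
    rw [Finset.eventually_all]
    intro i hi
    exact hC i (by simpa [Nat.lt_succ_iff] using hi)
  have hD' : ∀ᶠ ε in 𝓝[>] (0 : ℝ), ∀ i ∈ Finset.range (k + 1), ∀ x ∈ K,
      ‖iteratedFDeriv ℝ i (v ε) x‖ ≤ D i * ε ^ b := by
    rw [Finset.eventually_all]
    intro i hi
    exact hD i (by simpa [Nat.lt_succ_iff] using hi)
  filter_upwards [hC', hD', eventually_Ioo] with ε h1 h2 hε x hx
  have hε' : ε ∈ Ioc (0 : ℝ) 1 := ⟨hε.1, hε.2.le⟩
  have hxΩ : x ∈ (Ω : Set E) := hK hx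
  have key := B.norm_iteratedFDerivWithin_le_of_bilinear (hu ε hε') (hv ε hε')
    Ω.isOpen.uniqueDiffOn hxΩ (n := k) (by exact_mod_cast le_top)
  rw [iteratedFDerivWithin_of_isOpen k Ω.isOpen hxΩ] at key
  refine key.trans ?_
  rw [mul_assoc, Finset.sum_mul]
  refine mul_le_mul_of_nonneg_left (Finset.sum_le_sum fun i hi => ?_) (norm_nonneg B)
  rw [iteratedFDerivWithin_of_isOpen i Ω.isOpen hxΩ,
    iteratedFDerivWithin_of_isOpen (k - i) Ω.isOpen hxΩ, Real.rpow_add hε.1]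
  have hi' : i ≤ k := by simpa [Nat.lt_succ_iff] using hi
  have a1 := h1 i hi x hx
  have a2 := h2 (k - i) (by simp) x hx
  have := mul_le_mul a1 a2 (norm_nonneg _)
    (mul_nonneg (hC0 i hi') (Real.rpow_nonneg hε.1.le _))
  calc _ = (k.choose i : ℝ) *
        (‖iteratedFDeriv ℝ i (u ε) x‖ * ‖iteratedFDeriv ℝ (k - i) (v ε) x‖) := by ring
    _ ≤ (k.choose i : ℝ) * (C i * ε ^ a * (D (k - i) * ε ^ b)) := by gcongr
    _ = _ := by ring

theorem IsModerate.uniform {Ω : Opens E} {u : ℝ → E → F} (hu : IsModerate Ω u) {K : Set E}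
    (hc : IsCompact K) (hK : K ⊆ Ω) (k : ℕ) :
    ∃ p : ℝ, 0 ≤ p ∧ ∀ i ≤ k, BoundOn u K i (-p) := by
  choose p hp0 hp using hu.2 K hc hK
  refine ⟨∑ i ∈ Finset.range (k + 1), p i, Finset.sum_nonneg fun i _ => hp0 i, fun i hi => ?_⟩
  refine (hp i).mono (neg_le_neg ?_)
  exact Finset.single_le_sum (f := p) (fun i _ => hp0 i) (by simpa [Nat.lt_succ_iff] using hi)

theorem IsNull.isModerate {Ω : Opens E} {u : ℝ → E → F} (hu : IsNull Ω u) : IsModerate Ω u :=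
  ⟨hu.1, fun K hc hK k => ⟨0, le_rfl, by simpa using hu.2 K hc hK k 0 le_rfl⟩⟩

theorem IsSmoothFamily.add {Ω : Opens E} {u v : ℝ → E → F} (hu : IsSmoothFamily Ω u)
    (hv : IsSmoothFamily Ω v) : IsSmoothFamily Ω (u + v) :=
  fun ε hε => (hu ε hε).add (hv ε hε)

theorem IsModerate.add {Ω : Opens E} {u v : ℝ → E → F} (hu : IsModerate Ω u)
    (hv : IsModerate Ω v) : IsModerate Ω (u + v) := by
  refine ⟨hu.1.add hv.1, fun K hc hK k => ?_⟩
  obtain ⟨p, hp0, hp⟩ := hu.2 K hc hK k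
  obtain ⟨q, hq0, hq⟩ := hv.2 K hc hK k
  exact ⟨p + q, add_nonneg hp0 hq0, BoundOn.add hu.1 hv.1 hK (hp.mono (by linarith))
    (hq.mono (by linarith))⟩

theorem IsNull.add {Ω : Opens E} {u v : ℝ → E → F} (hu : IsNull Ω u)
    (hv : IsNull Ω v) : IsNull Ω (u + v) :=
  ⟨hu.1.add hv.1, fun K hc hK k q hq =>
    BoundOn.add hu.1 hv.1 hK (hu.2 K hc hK k q hq) (hv.2 K hc hK k q hq)⟩

theorem IsSmoothFamily.bilin (B : F →L[ℝ] G →L[ℝ] H) {Ω : Opens E} {u : ℝ → E → F}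
    {v : ℝ → E → G} (hu : IsSmoothFamily Ω u) (hv : IsSmoothFamily Ω v) :
    IsSmoothFamily Ω (fun ε x => B (u ε x) (v ε x)) :=
  fun ε hε =>
    ContDiff.comp_contDiffOn (g := fun p : F × G => B p.1 p.2) B.isBoundedBilinearMap.contDiff
      ((hu ε hε).prodMk (hv ε hε))

theorem IsModerate.bilin (B : F →L[ℝ] G →L[ℝ] H) {Ω : Opens E} {u : ℝ → E → F}
    {v : ℝ → E → G} (hu : IsModerate Ω u) (hv : IsModerate Ω v) :
    IsModerate Ω (fun ε x => B (u ε x) (v ε x)) := by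
  refine ⟨hu.1.bilin B hv.1, fun K hc hK k => ?_⟩
  obtain ⟨p, hp0, hp⟩ := hu.uniform hc hK k
  obtain ⟨q, hq0, hq⟩ := hv.uniform hc hK k
  refine ⟨p + q, add_nonneg hp0 hq0, ?_⟩
  have := BoundOn.bilin B hu.1 hv.1 hK hp hq
  rwa [← neg_add] at this

theorem IsModerate.bilin_null (B : F →L[ℝ] G →L[ℝ] H) {Ω : Opens E} {u : ℝ → E → F}
    {v : ℝ → E → G} (hu : IsModerate Ω u) (hv : IsNull Ω v) :
    IsNull Ω (fun ε x => B (u ε x) (v ε x)) := by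
  refine ⟨hu.1.bilin B hv.1, fun K hc hK k q hq => ?_⟩
  obtain ⟨p, hp0, hp⟩ := hu.uniform hc hK k
  have := BoundOn.bilin B hu.1 hv.1 hK hp
    (fun i _ => hv.2 K hc hK i (p + q) (add_nonneg hp0 hq))
  simpa using this

theorem isModerate_const (Ω : Opens E) (c : F) : IsModerate Ω (fun _ _ => c) := by
  refine ⟨fun ε _ => contDiffOn_const, fun K _ _ k => ⟨0, le_rfl, ‖c‖, ?_⟩⟩
  refine Eventually.of_forall fun ε x _ => ?_
  rcases k with _ | k
  · simp
  · simp [iteratedFDeriv_const_of_ne (𝕜 := ℝ) (E := E) (Nat.succ_ne_zero k) c]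

theorem isNull_zero (Ω : Opens E) : IsNull Ω (0 : ℝ → E → F) := by
  refine ⟨fun ε _ => contDiffOn_const, fun K _ _ k q _ => ⟨0, ?_⟩⟩
  refine Eventually.of_forall fun ε x _ => ?_
  simp

theorem IsSmoothFamily.fderiv {Ω : Opens E} {u : ℝ → E → F} (hu : IsSmoothFamily Ω u) :
    IsSmoothFamily Ω (fun ε => fderiv ℝ (u ε)) :=
  fun ε hε => (hu ε hε).fderiv_of_isOpen Ω.isOpen (by simp)

theorem boundOn_fderiv {u : ℝ → E → F} {K : Set E} {k : ℕ} {a : ℝ} :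
    BoundOn (fun ε => fderiv ℝ (u ε)) K k a ↔ BoundOn u K (k + 1) a := by
  simp only [BoundOn, norm_iteratedFDeriv_fderiv]

theorem IsModerate.fderiv {Ω : Opens E} {u : ℝ → E → F} (hu : IsModerate Ω u) :
    IsModerate Ω (fun ε => fderiv ℝ (u ε)) :=
  ⟨hu.1.fderiv, fun K hc hK k => by simpa only [boundOn_fderiv] using hu.2 K hc hK (k + 1)⟩

theorem IsNull.fderiv {Ω : Opens E} {u : ℝ → E → F} (hu : IsNull Ω u) :
    IsNull Ω (fun ε => fderiv ℝ (u ε)) :=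
  ⟨hu.1.fderiv, fun K hc hK k => by simpa only [boundOn_fderiv] using hu.2 K hc hK (k + 1)⟩

theorem IsModerate.mono {Ω Ω' : Opens E} (h : Ω' ≤ Ω) {u : ℝ → E → F} (hu : IsModerate Ω u) :
    IsModerate Ω' u :=
  ⟨fun ε hε => (hu.1 ε hε).mono h, fun K hc hK => hu.2 K hc (hK.trans h)⟩

theorem IsNull.mono {Ω Ω' : Opens E} (h : Ω' ≤ Ω) {u : ℝ → E → F} (hu : IsNull Ω u) :
    IsNull Ω' u :=
  ⟨fun ε hε => (hu.1 ε hε).mono h, fun K hc hK => hu.2 K hc (hK.trans h)⟩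

theorem IsSmoothFamily.comp_right (L : G →L[ℝ] E) {u : ℝ → E → F}
    (hu : IsSmoothFamily (⊤ : Opens E) u) :
    IsSmoothFamily (⊤ : Opens G) (fun ε x => u ε (L x)) :=
  fun ε hε => (hu ε hε).comp L.contDiff.contDiffOn (fun _ _ => trivial)

theorem BoundOn.comp_right (L : G →L[ℝ] E) {u : ℝ → E → F}
    (hu : IsSmoothFamily (⊤ : Opens E) u) {K : Set G} {k : ℕ} {a : ℝ}
    (h : BoundOn u (L '' K) k a) : BoundOn (fun ε x => u ε (L x)) K k a := by
  obtain ⟨C, hC⟩ := h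
  refine ⟨C * ‖L‖ ^ k, ?_⟩
  filter_upwards [hC, eventually_Ioo] with ε h1 hε x hx
  have hs : ContDiff ℝ ∞ (u ε) := by
    simpa [contDiffOn_univ] using hu ε ⟨hε.1, hε.2.le⟩
  have e : iteratedFDeriv ℝ k (fun x => u ε (L x)) x
      = (iteratedFDeriv ℝ k (u ε) (L x)).compContinuousLinearMap fun _ => L :=
    L.iteratedFDeriv_comp_right hs x (by exact_mod_cast le_top)
  rw [e]
  refine (ContinuousMultilinearMap.norm_compContinuousLinearMap_le _ _).trans ?_
  have := h1 (L x) (mem_image_of_mem L hx)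
  simp only [Finset.prod_const, Finset.card_univ, Fintype.card_fin]
  calc _ ≤ C * ε ^ a * ‖L‖ ^ k := by gcongr
    _ = _ := by ring

theorem IsModerate.comp_right (L : G →L[ℝ] E) {u : ℝ → E → F}
    (hu : IsModerate (⊤ : Opens E) u) : IsModerate (⊤ : Opens G) (fun ε x => u ε (L x)) := by
  refine ⟨hu.1.comp_right L, fun K hc _ k => ?_⟩
  obtain ⟨p, hp, h⟩ := hu.2 (L '' K) (hc.image L.continuous) (fun _ _ => trivial) k
  exact ⟨p, hp, h.comp_right L hu.1⟩

theorem IsNull.comp_right (L : G →L[ℝ] E) {u : ℝ → E → F}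
    (hu : IsNull (⊤ : Opens E) u) : IsNull (⊤ : Opens G) (fun ε x => u ε (L x)) :=
  ⟨hu.1.comp_right L, fun K hc _ k q hq =>
    (hu.2 (L '' K) (hc.image L.continuous) (fun _ _ => trivial) k q hq).comp_right L hu.1⟩

theorem SlowGrowth.fderiv {f : F → G} (hf : SlowGrowth f) : SlowGrowth (fderiv ℝ f) :=
  ⟨hf.1.fderiv_right (by simp), fun k => by
    simpa only [norm_iteratedFDeriv_fderiv] using hf.2 (k + 1)⟩

theorem IsSmoothFamily.comp_left {Ω : Opens E} {u : ℝ → E → F} (hu : IsSmoothFamily Ω u)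
    {f : F → G} (hf : SlowGrowth f) : IsSmoothFamily Ω (fun ε x => f (u ε x)) :=
  fun ε hε => hf.1.comp_contDiffOn (hu ε hε)

theorem SlowGrowth.exists_bound {f : F → G} (hf : SlowGrowth f) :
    ∃ (C : ℝ) (N : ℕ), 0 ≤ C ∧ ∀ y, ‖f y‖ ≤ C * (1 + ‖y‖) ^ N := by
  obtain ⟨C, N, h⟩ := hf.2 0
  refine ⟨C, N, ?_, fun y => by simpa using h y⟩
  have := (norm_nonneg _).trans (h 0)
  simpa using this

theorem BoundOn.comp_zero {Ω : Opens E} {u : ℝ → E → F} (hu : IsModerate Ω u)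
    {f : F → G} (hf : SlowGrowth f) {K : Set E} (hc : IsCompact K) (hK : K ⊆ Ω) :
    ∃ p : ℝ, 0 ≤ p ∧ BoundOn (fun ε x => f (u ε x)) K 0 (-p) := by
  obtain ⟨p, hp0, hp⟩ := hu.2 K hc hK 0
  obtain ⟨C, hC0, hC⟩ := hp.exists_nonneg
  obtain ⟨D, N, hD0, hD⟩ := hf.exists_bound
  refine ⟨p * N, by positivity, D * (1 + C) ^ N, ?_⟩
  filter_upwards [hC, eventually_Ioo] with ε h1 hε x hx
  have h2 : ‖u ε x‖ ≤ C * ε ^ (-p) := by simpa using h1 x hx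
  have h3 : 1 ≤ ε ^ (-p) := Real.one_le_rpow_of_pos_of_le_one_of_nonpos hε.1 hε.2.le (by linarith)
  have h4 : 1 + ‖u ε x‖ ≤ (1 + C) * ε ^ (-p) := by linarith
  rw [norm_iteratedFDeriv_zero]
  calc ‖f (u ε x)‖ ≤ D * (1 + ‖u ε x‖) ^ N := hD _
    _ ≤ D * ((1 + C) * ε ^ (-p)) ^ N := by gcongr
    _ = D * (1 + C) ^ N * ε ^ (-(p * N)) := by
      rw [mul_pow, ← Real.rpow_natCast (ε ^ (-p)), ← Real.rpow_mul hε.1.le]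
      ring_nf

theorem fderiv_comp_family {Ω : Opens E} {u : ℝ → E → F} (hu : IsSmoothFamily Ω u)
    {f : F → G} (hf : SlowGrowth f) {ε : ℝ} (hε : ε ∈ Ioc (0 : ℝ) 1) {x : E} (hx : x ∈ Ω) :
    _root_.fderiv ℝ (fun x => f (u ε x)) x =
      (_root_.fderiv ℝ f (u ε x)).comp (_root_.fderiv ℝ (u ε) x) := by
  have h1 : DifferentiableAt ℝ (u ε) x :=
    ((hu ε hε).contDiffAt (Ω.isOpen.mem_nhds hx)).differentiableAt (by simp)
  exact fderiv_comp x (hf.1.differentiable (by simp) _) h1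

end Families

section Superposition

universe w

variable {E : Type*} [NormedAddCommGroup E] [NormedSpace ℝ E]
  {F : Type w} [NormedAddCommGroup F] [NormedSpace ℝ F]

theorem BoundOn.comp_upTo {Ω : Opens E} {u : ℝ → E → F} (hu : IsModerate Ω u)
    {K : Set E} (hc : IsCompact K) (hK : K ⊆ Ω) (k : ℕ) :
    ∀ (G : Type w) [NormedAddCommGroup G] [NormedSpace ℝ G] (f : F → G), SlowGrowth f →
      ∃ p : ℝ, 0 ≤ p ∧ ∀ i ≤ k, BoundOn (fun ε x => f (u ε x)) K i (-p) := by
  induction k with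
  | zero =>
    intro G _ _ f hf
    obtain ⟨p, hp0, hp⟩ := BoundOn.comp_zero hu hf hc hK
    exact ⟨p, hp0, fun i hi => by obtain rfl : i = 0 := by omega
                                  exact hp⟩
  | succ k ih =>
    intro G _ _ f hf
    obtain ⟨p, hp0, hp⟩ := BoundOn.comp_zero hu hf hc hK
    obtain ⟨q, hq0, hq⟩ := ih (F →L[ℝ] G) (_root_.fderiv ℝ f) hf.fderiv
    obtain ⟨r, hr0, hr⟩ := hu.fderiv.uniform hc hK k
    refine ⟨p + (q + r), by positivity, fun i hi => ?_⟩
    rcases i with _ | i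
    · exact hp.mono (by linarith)
    · have key := BoundOn.bilin (ContinuousLinearMap.compL ℝ E F G)
        (hu.1.comp_left hf.fderiv) hu.1.fderiv hK (k := i)
        (fun j hj => hq j (by omega)) (fun j hj => hr j (by omega))
      rw [← boundOn_fderiv]
      refine (key.congr ?_).mono (by linarith)
      filter_upwards [eventually_Ioo] with ε hε x hx
      refine le_of_eq (congrArg _ (Filter.EventuallyEq.eq_of_nhds
        (Filter.EventuallyEq.iteratedFDeriv ℝ ?_ i)))
      filter_upwards [Ω.isOpen.mem_nhds (hK hx)] with y hy
      exact fderiv_comp_family hu.1 hf ⟨hε.1, hε.2.le⟩ hy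

theorem IsModerate.superpose {Ω : Opens E} {u : ℝ → E → F} (hu : IsModerate Ω u)
    {G : Type w} [NormedAddCommGroup G] [NormedSpace ℝ G] {f : F → G} (hf : SlowGrowth f) :
    IsModerate Ω (fun ε x => f (u ε x)) :=
  ⟨hu.1.comp_left hf, fun K hc hK k => by
    obtain ⟨p, hp0, hp⟩ := BoundOn.comp_upTo hu hc hK k G f hf
    exact ⟨p, hp0, hp k le_rfl⟩⟩

theorem norm_sub_le_of_slowGrowth {G : Type*} [NormedAddCommGroup G] [NormedSpace ℝ G]
    {f : F → G} (hf : SlowGrowth f) :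
    ∃ (D : ℝ) (N : ℕ), 0 ≤ D ∧
      ∀ y z, ‖f (y + z) - f y‖ ≤ D * (1 + (‖y‖ + ‖z‖)) ^ N * ‖z‖ := by
  obtain ⟨D, N, hD0, hD⟩ := hf.fderiv.exists_bound
  refine ⟨D, N, hD0, fun y z => ?_⟩
  have := (convex_closedBall (0 : F) (‖y‖ + ‖z‖)).norm_image_sub_le_of_norm_fderiv_le
    (𝕜 := ℝ) (f := f) (x := y) (y := y + z) (C := D * (1 + (‖y‖ + ‖z‖)) ^ N)
    (fun x _ => hf.1.differentiable (by simp) x)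
    (fun x hx => (hD x).trans (by
      have : ‖x‖ ≤ ‖y‖ + ‖z‖ := by simpa using hx
      gcongr))
    (by simp) (by simpa using norm_add_le y z)
  simpa using this

theorem BoundOn.comp_sub_zero {Ω : Opens E} {u n : ℝ → E → F} (hu : IsModerate Ω u)
    (hn : IsNull Ω n) {G : Type*} [NormedAddCommGroup G] [NormedSpace ℝ G]
    {f : F → G} (hf : SlowGrowth f) {K : Set E} (hc : IsCompact K)
    (hK : K ⊆ Ω) (q : ℝ) (hq : 0 ≤ q) :
    BoundOn (fun ε x => f (u ε x + n ε x) - f (u ε x)) K 0 q := by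
  obtain ⟨p, hp0, hp⟩ := hu.2 K hc hK 0
  obtain ⟨C, hC0, hC⟩ := hp.exists_nonneg
  obtain ⟨C', hC0', hC'⟩ := (hn.2 K hc hK 0 0 le_rfl).exists_nonneg
  obtain ⟨D, N, hD0, hD⟩ := norm_sub_le_of_slowGrowth hf
  obtain ⟨B, hB0, hB⟩ := (hn.2 K hc hK 0 (q + p * N) (by positivity)).exists_nonneg
  refine ⟨D * (1 + C + C') ^ N * B, ?_⟩
  filter_upwards [hC, hC', hB, eventually_Ioo] with ε h1 h1' h1'' hε x hx
  have h2 : ‖u ε x‖ ≤ C * ε ^ (-p) := by simpa using h1 x hx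
  have h2' : ‖n ε x‖ ≤ C' := by simpa using h1' x hx
  have h2'' : ‖n ε x‖ ≤ B * ε ^ (q + p * N) := by simpa using h1'' x hx
  have h3 : 1 ≤ ε ^ (-p) := Real.one_le_rpow_of_pos_of_le_one_of_nonpos hε.1 hε.2.le (by linarith)
  have h4 : 1 + (‖u ε x‖ + ‖n ε x‖) ≤ (1 + C + C') * ε ^ (-p) := by nlinarith
  rw [norm_iteratedFDeriv_zero]
  calc ‖f (u ε x + n ε x) - f (u ε x)‖ ≤ D * (1 + (‖u ε x‖ + ‖n ε x‖)) ^ N * ‖n ε x‖ := hD _ _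
    _ ≤ D * ((1 + C + C') * ε ^ (-p)) ^ N * (B * ε ^ (q + p * N)) := by gcongr
    _ = D * (1 + C + C') ^ N * B * (ε ^ (-p * N) * ε ^ (q + p * N)) := by
      rw [mul_pow, ← Real.rpow_natCast (ε ^ (-p)), ← Real.rpow_mul hε.1.le]
      ring
    _ = D * (1 + C + C') ^ N * B * ε ^ q := by
      rw [← Real.rpow_add hε.1]
      congr 2
      ring

theorem BoundOn.comp_sub_upTo {Ω : Opens E} {u n : ℝ → E → F} (hu : IsModerate Ω u)
    (hn : IsNull Ω n) {K : Set E} (hc : IsCompact K) (hK : K ⊆ Ω) (k : ℕ) :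
    ∀ (G : Type w) [NormedAddCommGroup G] [NormedSpace ℝ G] (f : F → G), SlowGrowth f →
      ∀ q : ℝ, 0 ≤ q →
        ∀ i ≤ k, BoundOn (fun ε x => f (u ε x + n ε x) - f (u ε x)) K i q := by
  induction k with
  | zero =>
    intro G _ _ f hf q hq i hi
    obtain rfl : i = 0 := by omega
    exact BoundOn.comp_sub_zero hu hn hf hc hK q hq
  | succ k ih =>
    intro G _ _ f hf q hq i hi
    rcases i with _ | i
    · exact BoundOn.comp_sub_zero hu hn hf hc hK q hq
    · have hun : IsModerate Ω (u + n) := hu.add hn.isModerate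
      obtain ⟨r, hr0, hr⟩ := hu.fderiv.uniform hc hK k
      have hs : IsSmoothFamily Ω
          (fun ε x => _root_.fderiv ℝ f (u ε x + n ε x) - _root_.fderiv ℝ f (u ε x)) :=
        fun ε hε => (hun.1.comp_left hf.fderiv ε hε).sub (hu.1.comp_left hf.fderiv ε hε)
      have k1 := BoundOn.bilin (ContinuousLinearMap.compL ℝ E F G) hs hu.1.fderiv hK (k := i)
        (fun j hj => ih (F →L[ℝ] G) (_root_.fderiv ℝ f) hf.fderiv (q + r) (by positivity) j
          (by omega)) (fun j hj => hr j (by omega))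
      have k2 := (IsModerate.bilin_null (ContinuousLinearMap.compL ℝ E F G)
        (hun.superpose hf.fderiv) hn.fderiv).2 K hc hK i q hq
      have k3 := BoundOn.add (hs.bilin (ContinuousLinearMap.compL ℝ E F G) hu.1.fderiv)
        ((hun.1.comp_left hf.fderiv).bilin (ContinuousLinearMap.compL ℝ E F G) hn.1.fderiv) hK
        (k1.mono (by linarith)) k2
      rw [← boundOn_fderiv]
      refine k3.congr ?_
      filter_upwards [eventually_Ioo] with ε hε x hx
      refine le_of_eq (congrArg _ (Filter.EventuallyEq.eq_of_nhds
        (Filter.EventuallyEq.iteratedFDeriv ℝ ?_ i)))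
      filter_upwards [Ω.isOpen.mem_nhds (hK hx)] with y hy
      have hε' : ε ∈ Ioc (0 : ℝ) 1 := ⟨hε.1, hε.2.le⟩
      have hyΩ := Ω.isOpen.mem_nhds hy
      have d1 : DifferentiableAt ℝ (fun x => f (u ε x + n ε x)) y :=
        ((hun.1.comp_left hf ε hε').contDiffAt hyΩ).differentiableAt (by simp)
      have d2 : DifferentiableAt ℝ (fun x => f (u ε x)) y :=
        ((hu.1.comp_left hf ε hε').contDiffAt hyΩ).differentiableAt (by simp)
      have d3 : DifferentiableAt ℝ (u ε) y :=
        ((hu.1 ε hε').contDiffAt hyΩ).differentiableAt (by simp)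
      have d4 : DifferentiableAt ℝ (n ε) y :=
        ((hn.1 ε hε').contDiffAt hyΩ).differentiableAt (by simp)
      have e1 := fderiv_comp_family hun.1 hf hε' hy
      have e2 := fderiv_comp_family hu.1 hf hε' hy
      have e3 : _root_.fderiv ℝ ((u + n) ε) y
          = _root_.fderiv ℝ (u ε) y + _root_.fderiv ℝ (n ε) y := fderiv_add d3 d4
      rw [e3] at e1
      have e4 := fderiv_sub d1 d2
      change _root_.fderiv ℝ (fun x => f (u ε x + n ε x)) y = _ at e1
      refine (e4.trans ?_)
      rw [e1, e2]
      ext v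
      simp [ContinuousLinearMap.compL_apply]
      abel

theorem IsNull.superpose_sub {Ω : Opens E} {u v : ℝ → E → F} (hu : IsModerate Ω u)
    (hv : IsModerate Ω v) (huv : IsNull Ω (v - u))
    {G : Type w} [NormedAddCommGroup G] [NormedSpace ℝ G] {f : F → G} (hf : SlowGrowth f) :
    IsNull Ω (fun ε x => f (v ε x) - f (u ε x)) := by
  refine ⟨fun ε hε => (hv.1.comp_left hf ε hε).sub (hu.1.comp_left hf ε hε),
    fun K hc hK k q hq => ?_⟩
  have := BoundOn.comp_sub_upTo hu huv hc hK k G f hf q hq k le_rfl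
  simpa using this

end Superposition

section Algebra

variable (𝕜 : Type*) [RCLike 𝕜] {E E' : Type*} [NormedAddCommGroup E] [NormedSpace ℝ E]
  [NormedAddCommGroup E'] [NormedSpace ℝ E']

/-- The algebra of moderate families on `Ω`. -/
def moderate (Ω : Opens E) : Subalgebra 𝕜 (ℝ → E → 𝕜) where
  carrier := {u | IsModerate Ω u}
  mul_mem' hu hv := hu.bilin (ContinuousLinearMap.mul ℝ 𝕜) hv
  add_mem' hu hv := hu.add hv
  algebraMap_mem' c := isModerate_const Ω c

/-- The ideal of null families on `Ω`. -/
def null (Ω : Opens E) : Ideal (moderate 𝕜 Ω) where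
  carrier := {u | IsNull Ω (u : ℝ → E → 𝕜)}
  add_mem' hu hv := IsNull.add hu hv
  zero_mem' := isNull_zero Ω
  smul_mem' c _ hu := IsModerate.bilin_null (ContinuousLinearMap.mul ℝ 𝕜) c.2 hu

/-- The (special) Colombeau algebra on `Ω`, with real (`𝕜 = ℝ`) or complex (`𝕜 = ℂ`) values. -/
abbrev GenFun (Ω : Opens E) : Type _ := moderate 𝕜 Ω ⧸ null 𝕜 Ω

variable {𝕜}

/-- The class of a moderate family. -/
def GenFun.mk {Ω : Opens E} (u : ℝ → E → 𝕜) (hu : IsModerate Ω u) : GenFun 𝕜 Ω :=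
  Ideal.Quotient.mk (null 𝕜 Ω) ⟨u, hu⟩

/-- `u` is a representative of the generalized function `U`. -/
def IsRep {Ω : Opens E} (u : ℝ → E → 𝕜) (U : GenFun 𝕜 Ω) : Prop :=
  ∃ hu : IsModerate Ω u, GenFun.mk u hu = U

theorem GenFun.mk_eq_mk {Ω : Opens E} {u v : ℝ → E → 𝕜} (hu : IsModerate Ω u)
    (hv : IsModerate Ω v) : GenFun.mk u hu = GenFun.mk v hv ↔ IsNull Ω (u - v) :=
  Ideal.Quotient.eq

/-- The map of generalized functions induced by an operation on families that respects moderate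
families and their equality modulo null families. -/
def GenFun.map {Ω : Opens E} {Ω' : Opens E'} (T : (ℝ → E → 𝕜) → (ℝ → E' → 𝕜))
    (hm : ∀ u, IsModerate Ω u → IsModerate Ω' (T u))
    (hn : ∀ u v, IsModerate Ω u → IsModerate Ω v → IsNull Ω (u - v) → IsNull Ω' (T u - T v)) :
    GenFun 𝕜 Ω → GenFun 𝕜 Ω' :=
  Quotient.lift (fun u : moderate 𝕜 Ω => GenFun.mk (T u) (hm u u.2)) fun u v huv =>
    (GenFun.mk_eq_mk _ _).2 (hn u v u.2 v.2
      ((GenFun.mk_eq_mk u.2 v.2).1 (Quotient.sound huv)))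

theorem GenFun.map_mk {Ω : Opens E} {Ω' : Opens E'} (T : (ℝ → E → 𝕜) → (ℝ → E' → 𝕜))
    (hm : ∀ u, IsModerate Ω u → IsModerate Ω' (T u))
    (hn : ∀ u v, IsModerate Ω u → IsModerate Ω v → IsNull Ω (u - v) → IsNull Ω' (T u - T v))
    (u : ℝ → E → 𝕜) (hu : IsModerate Ω u) :
    GenFun.map T hm hn (GenFun.mk u hu) = GenFun.mk (T u) (hm u hu) := rfl

theorem IsNull.congr {Ω : Opens E} {u v : ℝ → E → 𝕜} (hu : IsNull Ω u)
    (h : ∀ ε ∈ Ioc (0 : ℝ) 1, EqOn (v ε) (u ε) Ω) : IsNull Ω v := by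
  refine ⟨fun ε hε => (hu.1 ε hε).congr (h ε hε), fun K hc hK k q hq => ?_⟩
  refine (hu.2 K hc hK k q hq).congr ?_
  filter_upwards [eventually_Ioo] with ε hε x hx
  refine le_of_eq (congrArg _ (Filter.EventuallyEq.eq_of_nhds
    (Filter.EventuallyEq.iteratedFDeriv ℝ ?_ k)))
  filter_upwards [Ω.isOpen.mem_nhds (hK hx)] with y hy
  exact h ε ⟨hε.1, hε.2.le⟩ hy

/-- Directional derivative `∂_d` of families. -/
def dirDeriv (d : E) (u : ℝ → E → 𝕜) : ℝ → E → 𝕜 := fun ε x => fderiv ℝ (u ε) x d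

theorem IsModerate.dirDeriv {Ω : Opens E} {u : ℝ → E → 𝕜} (hu : IsModerate Ω u) (d : E) :
    IsModerate Ω (dirDeriv d u) :=
  (isModerate_const Ω d).bilin (ContinuousLinearMap.id ℝ (E →L[ℝ] 𝕜)).flip hu.fderiv

theorem IsNull.dirDeriv {Ω : Opens E} {u : ℝ → E → 𝕜} (hu : IsNull Ω u) (d : E) :
    IsNull Ω (dirDeriv d u) :=
  (isModerate_const Ω d).bilin_null (ContinuousLinearMap.id ℝ (E →L[ℝ] 𝕜)).flip hu.fderiv

/-- Directional derivative `∂_d` of generalized functions. -/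
def GenFun.deriv {Ω : Opens E} (d : E) : GenFun 𝕜 Ω → GenFun 𝕜 Ω :=
  GenFun.map (dirDeriv d) (fun _ hu => hu.dirDeriv d) fun u v hu hv h => by
    refine (h.dirDeriv d).congr fun ε hε x hx => ?_
    have hxΩ := Ω.isOpen.mem_nhds hx
    have d1 : DifferentiableAt ℝ (u ε) x :=
      ((hu.1 ε hε).contDiffAt hxΩ).differentiableAt (by simp)
    have d2 : DifferentiableAt ℝ (v ε) x :=
      ((hv.1 ε hε).contDiffAt hxΩ).differentiableAt (by simp)
    change fderiv ℝ (u ε) x d - fderiv ℝ (v ε) x d = fderiv ℝ (u ε - v ε) x d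
    rw [fderiv_sub d1 d2]
    rfl

/-- Restriction of generalized functions to a smaller open set. -/
def GenFun.restrict {Ω Ω' : Opens E} (h : Ω' ≤ Ω) : GenFun 𝕜 Ω → GenFun 𝕜 Ω' :=
  GenFun.map id (fun _ hu => hu.mono h) fun _ _ _ _ hn => hn.mono h

/-- The superposition `f(u)`, the class of `(f ∘ u_ε)`, for `f` smooth of slow growth. If `𝕜 = ℂ`,
then `f` is smooth as a function of two real variables. -/
def GenFun.superpose {Ω : Opens E} (f : 𝕜 → 𝕜) (hf : SlowGrowth f) : GenFun 𝕜 Ω → GenFun 𝕜 Ω :=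
  GenFun.map (fun u ε x => f (u ε x)) (fun _ hu => hu.superpose hf)
    fun _ _ hu hv hn => IsNull.superpose_sub hv hu hn hf

/-- The restriction `u|_{t = 0}` of a generalized function of `(x, t)`, the class of
`(u_ε(·, 0))`. -/
def GenFun.trace (u : GenFun 𝕜 (⊤ : Opens (ℝ × ℝ))) : GenFun 𝕜 (⊤ : Opens ℝ) :=
  GenFun.map (fun u ε x => u ε (x, 0))
    (fun _ hu => hu.comp_right (ContinuousLinearMap.inl ℝ ℝ ℝ))
    (fun _ _ _ _ hn => hn.comp_right (ContinuousLinearMap.inl ℝ ℝ ℝ)) u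

/-- The support: the complement in `Ω` of the largest open set on which `u` vanishes. -/
def GenFun.support {Ω : Opens E} (u : GenFun 𝕜 Ω) : Set E :=
  {x | x ∈ Ω ∧ ∀ (V : Opens E) (h : V ≤ Ω), x ∈ V → u.restrict h ≠ 0}

/-- The regular generalized functions `𝒢^∞(Ω)`. -/
def regular (𝕜 : Type*) [RCLike 𝕜] (Ω : Opens E) : Set (GenFun 𝕜 Ω) :=
  {U | ∃ u : ℝ → E → 𝕜, IsRep u U ∧ IsRegularFamily Ω u}

/-- The space `ℒ¹_𝒢(Ω)` of generalized functions with a representative that converges in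
`L¹_loc(Ω)` as `ε → 0`. -/
def locL1 (𝕜 : Type*) [RCLike 𝕜] [MeasureSpace E] (Ω : Opens E) : Set (GenFun 𝕜 Ω) :=
  {U | ∃ (u : ℝ → E → 𝕜) (w : E → 𝕜), IsRep u U ∧ LocallyIntegrableOn w Ω volume ∧
    ∀ K : Set E, IsCompact K → K ⊆ Ω →
      Tendsto (fun ε => ∫⁻ x in K, ‖u ε x - w x‖ₑ) (𝓝[>] 0) (𝓝 0)}

end Algebra

section Numbers

open Asymptotics

variable (𝕜 : Type*) [RCLike 𝕜]

theorem isBigO_rpow_of_le {a b : ℝ} (h : b ≤ a) :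
    (fun ε : ℝ => ε ^ a) =O[𝓝[>] 0] fun ε : ℝ => ε ^ b := by
  refine IsBigO.of_bound 1 ?_
  filter_upwards [eventually_Ioo] with ε hε
  rw [one_mul, Real.norm_of_nonneg (Real.rpow_nonneg hε.1.le _),
    Real.norm_of_nonneg (Real.rpow_nonneg hε.1.le _)]
  exact Real.rpow_le_rpow_of_exponent_ge hε.1 hε.2.le h

theorem isBigO_rpow_mul {r s : ℝ → 𝕜} {a b : ℝ} (hr : r =O[𝓝[>] 0] fun ε : ℝ => ε ^ a)
    (hs : s =O[𝓝[>] 0] fun ε : ℝ => ε ^ b) : (r * s) =O[𝓝[>] 0] fun ε : ℝ => ε ^ (a + b) := by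
  refine (hr.mul hs).congr' EventuallyEq.rfl ?_
  filter_upwards [eventually_Ioo] with ε hε
  exact (Real.rpow_add hε.1 a b).symm

/-- Moderate families of numbers; only the values for `0 < ε ≤ 1` near `0` matter. -/
def moderateNum : Subalgebra 𝕜 (ℝ → 𝕜) where
  carrier := {r | ∃ p : ℝ, 0 ≤ p ∧ r =O[𝓝[>] 0] fun ε : ℝ => ε ^ (-p)}
  mul_mem' := by
    rintro r s ⟨p, hp, hr⟩ ⟨q, hq, hs⟩
    refine ⟨p + q, add_nonneg hp hq, ?_⟩
    rw [neg_add]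
    exact isBigO_rpow_mul 𝕜 hr hs
  add_mem' := by
    rintro r s ⟨p, hp, hr⟩ ⟨q, hq, hs⟩
    exact ⟨p + q, add_nonneg hp hq, (hr.trans (isBigO_rpow_of_le (by linarith))).add
      (hs.trans (isBigO_rpow_of_le (by linarith)))⟩
  algebraMap_mem' c := by
    refine ⟨0, le_rfl, ?_⟩
    simpa using isBigO_const_const (algebraMap 𝕜 𝕜 c) (one_ne_zero (α := ℝ)) (𝓝[>] (0 : ℝ))

/-- Negligible families of numbers. -/
def negligibleNum : Ideal (moderateNum 𝕜) where
  carrier := {r | ∀ q : ℝ, 0 ≤ q → (r : ℝ → 𝕜) =O[𝓝[>] 0] fun ε : ℝ => ε ^ q}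
  add_mem' hr hs q hq := (hr q hq).add (hs q hq)
  zero_mem' q _ := isBigO_zero _ _
  smul_mem' := by
    rintro ⟨c, p, hp, hc⟩ r hr q hq
    have := isBigO_rpow_mul 𝕜 hc (hr (p + q) (add_nonneg hp hq))
    rwa [neg_add_cancel_left] at this

/-- The ring of Colombeau generalized numbers. -/
abbrev GenNum : Type _ := moderateNum 𝕜 ⧸ negligibleNum 𝕜

variable {𝕜}

/-- `r` is a representative of the generalized number `R`. -/
def IsNumRep (r : ℝ → 𝕜) (R : GenNum 𝕜) : Prop :=
  ∃ hr : r ∈ moderateNum 𝕜, Ideal.Quotient.mk (negligibleNum 𝕜) ⟨r, hr⟩ = R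

/-- `M ≈ m`: the representatives of `M` converge to the number `m`. -/
def GenNum.AssociatedTo (M : GenNum 𝕜) (m : 𝕜) : Prop :=
  ∃ r : ℝ → 𝕜, IsNumRep r M ∧ Tendsto r (𝓝[>] 0) (𝓝 m)

/-- `|M| ≈ ∞`: the absolute values of the representatives of `M` tend to infinity. -/
def GenNum.AbsInfinite (M : GenNum 𝕜) : Prop :=
  ∃ r : ℝ → 𝕜, IsNumRep r M ∧ Tendsto (fun ε => ‖r ε‖) (𝓝[>] 0) atTop

/-- `M` is the class of `½ ∫ s_ε(x) dx`, where `(s_ε)` is a representative of `s` whose members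
all vanish outside a common compact interval. -/
def IsHalfIntegral (s : GenFun 𝕜 (⊤ : Opens ℝ)) (M : GenNum 𝕜) : Prop :=
  ∃ (u : ℝ → ℝ → 𝕜) (R : ℝ), IsRep u s ∧ (∀ ε ∈ Ioc (0 : ℝ) 1, ∀ x, R < |x| → u ε x = 0) ∧
    IsNumRep (fun ε => (1 / 2 : 𝕜) * ∫ x, u ε x) M

end Numbers

section Wave

variable {𝕜 : Type*} [RCLike 𝕜]

/-- `u` solves `∂_t² u - ∂_x² u = f(u)`, `u|_{t=0} = u₀`, `∂_t u|_{t=0} = u₁` in the Colombeau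
algebra on the plane. A point of the plane is `(x, t)`. -/
structure IsWaveSolution (f : 𝕜 → 𝕜) (hf : SlowGrowth f) (u₀ u₁ : GenFun 𝕜 (⊤ : Opens ℝ))
    (u : GenFun 𝕜 (⊤ : Opens (ℝ × ℝ))) : Prop where
  equation : (u.deriv (0, 1)).deriv (0, 1) - (u.deriv (1, 0)).deriv (1, 0) = u.superpose f hf
  initial : u.trace = u₀
  initial_deriv : (u.deriv (0, 1)).trace = u₁

/-- The forward and backward light cone `S = {|x| = |t|}`. -/
def lightCone : Set (ℝ × ℝ) := {z | |z.1| = |z.2|}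

/-- The open set `ℝ² ∖ S`. -/
def offLightCone : Opens (ℝ × ℝ) :=
  ⟨lightConeᶜ, (isClosed_eq continuous_fst.abs continuous_snd.abs).isOpen_compl⟩

end Wave

end

end Colombeau

namespace Colombeau

open Filter Topology Set MeasureTheory TopologicalSpace
open scoped ContDiff

noncomputable section

/-! ### Representatives, local uniform convergence and `L¹_loc` convergence. -/

section Representatives

variable {𝕜 : Type*} [RCLike 𝕜] {E : Type*} [NormedAddCommGroup E] [NormedSpace ℝ E]

/-! The singular data interact with the nonlinearity so weakly that they may be split off linearly.
Let `v` represent the solution, let `a`, `b` represent `s₀`, `s₁` (with `b` supported in a common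
compact interval), and let `g` be the free wave with data `a`, `b`, given by d'Alembert's formula.
Off the light cone `x + t` and `x - t` are nonzero, so every derivative of `g` of positive order
involves only values of `a`, `b` and their derivatives away from the origin, which are negligible.
The growth of `g` itself therefore serves for all orders, and `g` is regular there
(`isRegularFamily_freeWave`).

It remains to show that `v - g` converges in `L¹_loc`. In the characteristic coordinates `ξ = x +
t`, `η = x - t` the wave operator is `-4 ∂_ξ ∂_η`, and `v = ρ + σ + k`, where `ρ` is the free wave
with data `v₀ - a`, `v₁ - b`, `σ` is `g`, and `k` is `1/4` of the integral of `f(ρ + σ + k) + N`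
over the characteristic triangle, with a null residual `N` (`characteristic_formula`). The data of
`ρ` represent `r₀`, `r₁`, so `ρ` converges in `L¹` on squares to some `w` (`exists_limit_charWave`).
Off the cone `σ` is asymptotic to `0`, `M` or `-M` (`exists_tendsto_freeWave_sub`), so at almost
every point it converges or becomes infinitely large.

Boundedness of `f` bounds `k` uniformly. Hence, at almost every point, `f(w + σ + k)` for two
parameters differs by at most `L` times the difference of the `k`'s plus a defect tending to zero:
if `σ` converges, by the Lipschitz condition; if `|σ| → ∞`, because both values approach the limit
of `f` at infinity (`tendsto_lipschitz_defect`). The defects are bounded, so their integrals vanish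
in the limit, and a Gronwall inequality on characteristic triangles makes `k` uniformly Cauchy on
squares (`uniformCauchySeqOn_of_integral_equation`). Its limit is continuous, and `v - g = ρ + k`
converges in `L¹_loc`. -/

theorem GenFun.exists_isRep {Ω : Opens E} (U : GenFun 𝕜 Ω) : ∃ u, IsRep u U := by
  obtain ⟨⟨u, hu⟩, rfl⟩ := Ideal.Quotient.mk_surjective U
  exact ⟨u, hu, rfl⟩

theorem IsModerate.sub {Ω : Opens E} {u v : ℝ → E → 𝕜} (hu : IsModerate Ω u)
    (hv : IsModerate Ω v) : IsModerate Ω (u - v) :=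
  (moderate 𝕜 Ω).sub_mem hu hv

theorem IsRep.sub {Ω : Opens E} {u v : ℝ → E → 𝕜} {U V : GenFun 𝕜 Ω} (hu : IsRep u U)
    (hv : IsRep v V) : IsRep (u - v) (U - V) := by
  obtain ⟨hu, rfl⟩ := hu
  obtain ⟨hv, rfl⟩ := hv
  exact ⟨hu.sub hv, rfl⟩

theorem IsRep.isNull_sub {Ω : Opens E} {u v : ℝ → E → 𝕜} {U : GenFun 𝕜 Ω} (hu : IsRep u U)
    (hv : IsRep v U) : IsNull Ω (u - v) := by
  obtain ⟨hu, rfl⟩ := hu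
  obtain ⟨hv, h⟩ := hv
  exact (GenFun.mk_eq_mk hu hv).1 h.symm

theorem IsSmoothFamily.contDiff {F : Type*} [NormedAddCommGroup F] [NormedSpace ℝ F]
    {u : ℝ → E → F} (hu : IsSmoothFamily (⊤ : Opens E) u) {ε : ℝ}
    (hε : ε ∈ Ioc (0 : ℝ) 1) : ContDiff ℝ ∞ (u ε) := by
  simpa [contDiffOn_univ] using hu ε hε

theorem tendsto_of_le_mul_rpow {F : Type*} [NormedAddCommGroup F] {φ : ℝ → F} {C q : ℝ}
    (hq : 0 < q) (h : ∀ᶠ ε in 𝓝[>] (0 : ℝ), ‖φ ε‖ ≤ C * ε ^ q) :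
    Tendsto φ (𝓝[>] 0) (𝓝 0) := by
  refine squeeze_zero_norm' h ?_
  have h1 : Tendsto (fun ε : ℝ => ε ^ q) (𝓝 0) (𝓝 (0 ^ q)) :=
    (Real.continuousAt_rpow_const 0 q (Or.inr hq.le)).tendsto
  rw [Real.zero_rpow hq.ne'] at h1
  simpa using (h1.mono_left nhdsWithin_le_nhds).const_mul C

/-- Families bounded by a positive power of `ε` on `K` tend to zero uniformly on `K`. -/
theorem BoundOn.tendstoUniformlyOn {F : Type*} [NormedAddCommGroup F] [NormedSpace ℝ F]
    {u : ℝ → E → F} {K : Set E} {q : ℝ} (hq : 0 < q) (h : BoundOn u K 0 q) :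
    TendstoUniformlyOn u 0 (𝓝[>] 0) K := by
  obtain ⟨C, hC0, hC⟩ := h.exists_nonneg
  have h1 : Tendsto (fun ε : ℝ => C * ε ^ q) (𝓝[>] 0) (𝓝 0) := by
    refine tendsto_of_le_mul_rpow (C := C) hq ?_
    filter_upwards [eventually_Ioo] with ε hε
    rw [Real.norm_of_nonneg (mul_nonneg hC0 (Real.rpow_nonneg hε.1.le _))]
  rw [Metric.tendstoUniformlyOn_iff]
  intro δ hδ
  filter_upwards [hC, h1.eventually_lt_const hδ] with ε h2 h3 x hx
  rw [Pi.zero_apply, dist_zero_left]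
  exact lt_of_le_of_lt (by simpa using h2 x hx) h3

theorem IsNull.tendstoUniformlyOn {F : Type*} [NormedAddCommGroup F] [NormedSpace ℝ F]
    {Ω : Opens E} {u : ℝ → E → F} (hu : IsNull Ω u) {K : Set E}
    (hc : IsCompact K) (hK : K ⊆ Ω) : TendstoUniformlyOn u 0 (𝓝[>] 0) K :=
  (hu.2 K hc hK 0 1 zero_le_one).tendstoUniformlyOn one_pos

theorem tendsto_setLIntegral_enorm_of_tendstoUniformlyOn {α F ι : Type*} [MeasurableSpace α]
    [NormedAddCommGroup F] {μ : Measure α} {l : Filter ι} {u : ι → α → F} {w : α → F} {K : Set α}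
    (hK : μ K ≠ ⊤) (h : TendstoUniformlyOn u w l K) (hm : MeasurableSet K) :
    Tendsto (fun ε => ∫⁻ x in K, ‖u ε x - w x‖ₑ ∂μ) l (𝓝 0) := by
  rw [ENNReal.tendsto_nhds_zero]
  intro δ hδ
  rcases eq_or_ne δ ⊤ with rfl | hδ'
  · simp
  obtain ⟨c, hc0, hc⟩ : ∃ c : ℝ, 0 < c ∧ ENNReal.ofReal c * μ K ≤ δ := by
    have hδ0 : 0 < δ.toReal := ENNReal.toReal_pos hδ.ne' hδ'
    -- The summand `1` keeps the denominator positive when `K` has measure zero.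
    refine ⟨δ.toReal / ((μ K).toReal + 1), by positivity, ?_⟩
    rw [← ENNReal.ofReal_toReal hK, ← ENNReal.ofReal_mul (by positivity),
      ENNReal.ofReal_le_iff_le_toReal hδ', ENNReal.toReal_ofReal ENNReal.toReal_nonneg,
      div_mul_eq_mul_div, div_le_iff₀ (by positivity)]
    nlinarith [ENNReal.toReal_nonneg (a := μ K)]
  rw [Metric.tendstoUniformlyOn_iff] at h
  filter_upwards [h c hc0] with ε hε
  refine le_trans ?_ hc
  rw [← setLIntegral_const]
  refine setLIntegral_mono' hm fun x hx => ?_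
  have := hε x hx
  rw [dist_eq_norm'] at this
  rw [← ofReal_norm]
  exact ENNReal.ofReal_le_ofReal this.le

/-- `L¹_loc` convergence does not depend on the representative. -/
theorem exists_limit_of_mem_locL1 {U : GenFun 𝕜 (⊤ : Opens ℝ)} (hU : U ∈ locL1 𝕜 (⊤ : Opens ℝ)) :
    ∃ w : ℝ → 𝕜, LocallyIntegrable w ∧ ∀ u, IsRep u U → ∀ R : ℝ,
      Tendsto (fun ε => ∫⁻ x in Icc (-R) R, ‖u ε x - w x‖ₑ) (𝓝[>] 0) (𝓝 0) := by
  obtain ⟨v, w, hv, hw, h⟩ := hU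
  refine ⟨w, locallyIntegrableOn_univ.1 (by simpa using hw), fun u hu R => ?_⟩
  have h1 := h (Icc (-R) R) isCompact_Icc (fun _ _ => trivial)
  have hn := hu.isNull_sub hv
  have h2 := tendsto_setLIntegral_enorm_of_tendstoUniformlyOn (μ := volume)
    isCompact_Icc.measure_ne_top
    (hn.tendstoUniformlyOn (isCompact_Icc (a := -R) (b := R)) (fun _ _ => trivial))
    measurableSet_Icc
  have h3 := h2.add h1
  rw [add_zero] at h3
  refine tendsto_of_tendsto_of_tendsto_of_le_of_le' tendsto_const_nhds h3
    (Eventually.of_forall fun _ => zero_le) ?_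
  filter_upwards [eventually_Ioo] with ε hε
  have hc : Continuous ((u - v) ε) := (hn.1.contDiff ⟨hε.1, hε.2.le⟩).continuous
  rw [← lintegral_add_left (by simpa using hc.enorm.measurable)]
  refine lintegral_mono fun x => ?_
  have : u ε x - w x = ((u - v) ε x - (0 : ℝ → 𝕜) x) + (v ε x - w x) := by simp
  rw [this]
  exact enorm_add_le _ _

theorem BoundOn.mono_set {F : Type*} [NormedAddCommGroup F] [NormedSpace ℝ F] {u : ℝ → E → F}
    {K K' : Set E} {k : ℕ} {a : ℝ} (h : BoundOn u K k a) (hK : K' ⊆ K) : BoundOn u K' k a := by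
  obtain ⟨C, hC⟩ := h
  exact ⟨C, hC.mono fun ε h x hx => h x (hK hx)⟩

theorem BoundOn.union {F : Type*} [NormedAddCommGroup F] [NormedSpace ℝ F] {u : ℝ → E → F}
    {K K' : Set E} {k : ℕ} {a : ℝ} (h : BoundOn u K k a) (h' : BoundOn u K' k a) :
    BoundOn u (K ∪ K') k a := by
  obtain ⟨C, hC⟩ := h
  obtain ⟨D, hD⟩ := h'
  refine ⟨max C D, ?_⟩
  filter_upwards [hC, hD, eventually_Ioo] with ε h1 h2 hε x hx
  have := Real.rpow_nonneg hε.1.le a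
  rcases hx with hx | hx
  · exact (h1 x hx).trans (mul_le_mul_of_nonneg_right (le_max_left _ _) this)
  · exact (h2 x hx).trans (mul_le_mul_of_nonneg_right (le_max_right _ _) this)

/-- Off its support, a generalized function is given by null families. -/
theorem IsRep.boundOn_of_disjoint_support [LocallyCompactSpace E] {Ω : Opens E} {u : ℝ → E → 𝕜}
    {U : GenFun 𝕜 Ω}
    (hu : IsRep u U) {K : Set E} (hc : IsCompact K) (hK : K ⊆ Ω) (hd : ∀ x ∈ K, x ∉ U.support)
    (k : ℕ) {q : ℝ} (hq : 0 ≤ q) : BoundOn u K k q := by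
  refine hc.induction_on (p := fun K => BoundOn u K k q) ?_ (fun _ _ h h' => h'.mono_set h)
    (fun _ _ => BoundOn.union) fun x hx => ?_
  · exact ⟨0, by simp⟩
  obtain ⟨V, hV, hxV, h0⟩ : ∃ (V : Opens E) (h : V ≤ Ω), x ∈ V ∧ U.restrict h = 0 := by
    have := hd x hx
    simp only [GenFun.support, mem_ofPred_eq, not_and, not_forall, not_not] at this
    obtain ⟨V, h, hx, h0⟩ := this (hK hx)
    exact ⟨V, h, hx, h0⟩
  have hn : IsNull V u := by
    obtain ⟨hu, rfl⟩ := hu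
    have := (GenFun.mk_eq_mk (hu.mono hV) (isNull_zero (F := 𝕜) V).isModerate).1 h0
    simpa using this
  obtain ⟨N, hN, hNV, hNc⟩ := local_compact_nhds (V.isOpen.mem_nhds hxV)
  exact ⟨N, mem_nhdsWithin_of_mem_nhds hN, hn.2 N hNc hNV k q hq⟩

end Representatives

/-! ### D'Alembert's free waves and their behaviour off the light cone. -/

section FreeWaves

variable {𝕜 : Type*} [RCLike 𝕜]

/-- The family of primitives vanishing at `0`. -/
def primitive (b : ℝ → ℝ → 𝕜) : ℝ → ℝ → 𝕜 := fun ε x => ∫ y in 0..x, b ε y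

theorem IsSmoothFamily.hasDerivAt_primitive {b : ℝ → ℝ → 𝕜}
    (hb : IsSmoothFamily (⊤ : Opens ℝ) b) {ε : ℝ} (hε : ε ∈ Ioc (0 : ℝ) 1) (x : ℝ) :
    HasDerivAt (primitive b ε) (b ε x) x :=
  (hb.contDiff hε).continuous.integral_hasStrictDerivAt 0 x |>.hasDerivAt

theorem IsSmoothFamily.deriv_primitive {b : ℝ → ℝ → 𝕜}
    (hb : IsSmoothFamily (⊤ : Opens ℝ) b) {ε : ℝ} (hε : ε ∈ Ioc (0 : ℝ) 1) :
    deriv (primitive b ε) = b ε :=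
  funext fun x => (hb.hasDerivAt_primitive hε x).deriv

theorem IsSmoothFamily.primitive {b : ℝ → ℝ → 𝕜} (hb : IsSmoothFamily (⊤ : Opens ℝ) b) :
    IsSmoothFamily (⊤ : Opens ℝ) (primitive b) := fun ε hε => by
  refine ContDiff.contDiffOn (contDiff_infty_iff_deriv.2 ⟨fun x =>
    (hb.hasDerivAt_primitive hε x).differentiableAt, ?_⟩)
  rw [hb.deriv_primitive hε]
  exact hb.contDiff hε

theorem IsSmoothFamily.boundOn_primitive_succ {b : ℝ → ℝ → 𝕜}
    (hb : IsSmoothFamily (⊤ : Opens ℝ) b) {K : Set ℝ} {k : ℕ} {a : ℝ} (h : BoundOn b K k a) :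
    BoundOn (Colombeau.primitive b) K (k + 1) a := by
  refine h.congr ?_
  filter_upwards [eventually_Ioo] with ε hε x _
  rw [norm_iteratedFDeriv_eq_norm_iteratedDeriv, norm_iteratedFDeriv_eq_norm_iteratedDeriv,
    iteratedDeriv_succ', hb.deriv_primitive ⟨hε.1, hε.2.le⟩]

theorem IsModerate.primitive {b : ℝ → ℝ → 𝕜} (hb : IsModerate (⊤ : Opens ℝ) b) :
    IsModerate (⊤ : Opens ℝ) (primitive b) := by
  refine ⟨hb.1.primitive, fun K hc hK k => ?_⟩
  rcases k with _ | k
  · obtain ⟨R, hR0, hR⟩ := hc.isBounded.subset_closedBall_lt 0 0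
    obtain ⟨p, hp, h⟩ := hb.2 (Icc (-R) R) isCompact_Icc (fun _ _ => trivial) 0
    obtain ⟨C, hC0, hC⟩ := h.exists_nonneg
    refine ⟨p, hp, C * R, ?_⟩
    filter_upwards [hC, eventually_Ioo] with ε h1 hε x hx
    have hx' : |x| ≤ R := by simpa using hR hx
    rw [norm_iteratedFDeriv_zero]
    refine (intervalIntegral.norm_integral_le_of_norm_le_const (C := C * ε ^ (-p)) ?_).trans ?_
    · intro y hy
      have hy' : |y| ≤ |x| := by
        rcases le_total 0 x with h | h
        · rw [uIoc_of_le h] at hy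
          rw [abs_of_pos hy.1, abs_of_nonneg h]
          exact hy.2
        · rw [uIoc_of_ge h] at hy
          rw [abs_of_nonpos hy.2, abs_of_nonpos h]
          linarith [hy.1]
      simpa using h1 y (abs_le.1 (hy'.trans hx'))
    · rw [sub_zero]
      calc C * ε ^ (-p) * |x| ≤ C * ε ^ (-p) * R := by
            have := Real.rpow_nonneg hε.1.le (-p)
            gcongr
        _ = _ := by ring
  · obtain ⟨p, hp, h⟩ := hb.2 K hc hK k
    exact ⟨p, hp, hb.1.boundOn_primitive_succ h⟩

theorem BoundOn.const_smul {E : Type*} [NormedAddCommGroup E] [NormedSpace ℝ E]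
    {Ω : Opens E} {u : ℝ → E → 𝕜} (hu : IsSmoothFamily Ω u) {K : Set E} (hK : K ⊆ Ω) {k : ℕ}
    {a : ℝ} (c : 𝕜) (h : BoundOn u K k a) : BoundOn (c • u) K k a := by
  obtain ⟨C, hC⟩ := h
  refine ⟨‖c‖ * C, ?_⟩
  filter_upwards [hC, eventually_Ioo] with ε h1 hε x hx
  have hd : ContDiffAt ℝ k (u ε) x := ((hu ε ⟨hε.1, hε.2.le⟩).contDiffAt
    (Ω.isOpen.mem_nhds (hK hx))).of_le (by exact_mod_cast le_top)
  have : iteratedFDeriv ℝ k ((c • u) ε) x = c • iteratedFDeriv ℝ k (u ε) x :=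
    iteratedFDeriv_const_smul_apply (a := c) hd
  rw [this, norm_smul, mul_assoc]
  gcongr
  exact h1 x hx

theorem IsModerate.const_smul {E : Type*} [NormedAddCommGroup E] [NormedSpace ℝ E]
    {Ω : Opens E} {u : ℝ → E → 𝕜} (hu : IsModerate Ω u) (c : 𝕜) : IsModerate Ω (c • u) :=
  (moderate 𝕜 Ω).smul_mem hu c

/-- The part depending on `x + t` of the free wave with initial data `a`, `b`. -/
def leftMoving (a b : ℝ → ℝ → 𝕜) : ℝ → ℝ → 𝕜 := (2⁻¹ : 𝕜) • (a + primitive b)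

/-- The part depending on `x - t` of the free wave with initial data `a`, `b`. -/
def rightMoving (a b : ℝ → ℝ → 𝕜) : ℝ → ℝ → 𝕜 := (2⁻¹ : 𝕜) • (a - primitive b)

/-- The free wave with initial data `a`, `b` (d'Alembert's formula). -/
def freeWave (a b : ℝ → ℝ → 𝕜) : ℝ → ℝ × ℝ → 𝕜 :=
  fun ε z => leftMoving a b ε (z.1 + z.2) + rightMoving a b ε (z.1 - z.2)

theorem IsModerate.leftMoving {a b : ℝ → ℝ → 𝕜} (ha : IsModerate (⊤ : Opens ℝ) a)
    (hb : IsModerate (⊤ : Opens ℝ) b) : IsModerate (⊤ : Opens ℝ) (leftMoving a b) :=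
  (ha.add hb.primitive).const_smul _

theorem IsModerate.rightMoving {a b : ℝ → ℝ → 𝕜} (ha : IsModerate (⊤ : Opens ℝ) a)
    (hb : IsModerate (⊤ : Opens ℝ) b) : IsModerate (⊤ : Opens ℝ) (rightMoving a b) :=
  (ha.sub hb.primitive).const_smul _

/-- The coordinate `x + t`. -/
def sumCLM : ℝ × ℝ →L[ℝ] ℝ := ContinuousLinearMap.fst ℝ ℝ ℝ + ContinuousLinearMap.snd ℝ ℝ ℝ

/-- The coordinate `x - t`. -/
def diffCLM : ℝ × ℝ →L[ℝ] ℝ := ContinuousLinearMap.fst ℝ ℝ ℝ - ContinuousLinearMap.snd ℝ ℝ ℝ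

theorem IsModerate.freeWave {a b : ℝ → ℝ → 𝕜} (ha : IsModerate (⊤ : Opens ℝ) a)
    (hb : IsModerate (⊤ : Opens ℝ) b) : IsModerate (⊤ : Opens (ℝ × ℝ)) (freeWave a b) :=
  ((ha.leftMoving hb).comp_right sumCLM).add ((ha.rightMoving hb).comp_right diffCLM)

/-- All bounds on compact sets off the origin, as for families representing generalized functions
supported at the origin. -/
def NullOffZero (a : ℝ → ℝ → 𝕜) : Prop :=
  ∀ K : Set ℝ, IsCompact K → 0 ∉ K → ∀ (k : ℕ) (q : ℝ), 0 ≤ q → BoundOn a K k q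

theorem IsRep.nullOffZero {U : GenFun 𝕜 (⊤ : Opens ℝ)} {a : ℝ → ℝ → 𝕜} (ha : IsRep a U)
    (hU : U.support ⊆ {0}) : NullOffZero a := fun K hc h0 k q hq =>
  ha.boundOn_of_disjoint_support hc (fun _ _ => trivial)
    (fun x hx hx' => h0 (by rwa [← mem_singleton_iff.1 (hU hx')])) k hq

theorem NullOffZero.tendstoUniformlyOn {a : ℝ → ℝ → 𝕜} (ha : NullOffZero a) {K : Set ℝ}
    (hc : IsCompact K) (h0 : 0 ∉ K) : TendstoUniformlyOn a 0 (𝓝[>] 0) K :=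
  (ha K hc h0 0 1 zero_le_one).tendstoUniformlyOn one_pos

/-- One differentiation turns the primitive of `b` back into `b`, which is negligible off the
origin. Order zero is excluded because the primitive remembers the mass of `b` at the origin and may
be large everywhere. -/
theorem boundOn_moving_succ {a b : ℝ → ℝ → 𝕜} (ha : IsModerate (⊤ : Opens ℝ) a)
    (hb : IsModerate (⊤ : Opens ℝ) b) (ha0 : NullOffZero a) (hb0 : NullOffZero b) {K : Set ℝ}
    (hc : IsCompact K) (h0 : 0 ∉ K) (k : ℕ) :
    BoundOn (leftMoving a b) K (k + 1) 0 ∧ BoundOn (rightMoving a b) K (k + 1) 0 := by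
  have hK : K ⊆ (⊤ : Opens ℝ) := fun _ _ => trivial
  have h1 := ha0 K hc h0 (k + 1) 0 le_rfl
  have h2 := hb.1.boundOn_primitive_succ (hb0 K hc h0 k 0 le_rfl)
  have h3 := h2.const_smul hb.primitive.1 hK (-1)
  refine ⟨(BoundOn.add ha.1 hb.primitive.1 hK h1 h2).const_smul (ha.add hb.primitive).1 hK _, ?_⟩
  have h4 := (BoundOn.add ha.1 (hb.primitive.const_smul (-1)).1 hK h1 h3).const_smul
    (ha.add (hb.primitive.const_smul (-1))).1 hK (2⁻¹ : 𝕜)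
  simpa only [rightMoving, neg_one_smul, ← sub_eq_add_neg] using h4

/-- Positive orders are bounded in `ε`, because `x + t` and `x - t` map a compact set off the cone
to compact sets avoiding `0`. The exponent for order zero therefore works for every order. -/
theorem isRegularFamily_freeWave {a b : ℝ → ℝ → 𝕜} (ha : IsModerate (⊤ : Opens ℝ) a)
    (hb : IsModerate (⊤ : Opens ℝ) b) (ha0 : NullOffZero a) (hb0 : NullOffZero b) :
    IsRegularFamily offLightCone (freeWave a b) := by
  have hv := ha.freeWave hb
  refine ⟨(hv.mono le_top).1, fun K hc hK => ?_⟩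
  obtain ⟨p, hp, h⟩ := hv.2 K hc (fun _ _ => trivial) 0
  have hS : ∀ z ∈ K, |z.1| ≠ |z.2| := fun z hz => hK hz
  have hl := (ha.leftMoving hb).1
  have hr := (ha.rightMoving hb).1
  refine ⟨p, hp, fun k => ?_⟩
  rcases k with _ | k
  · exact h
  have h1 : 0 ∉ sumCLM '' K := by
    rintro ⟨z, hz, h⟩
    refine hS z hz ?_
    rw [eq_neg_of_add_eq_zero_left (show z.1 + z.2 = 0 from h), abs_neg]
  have h2 : 0 ∉ diffCLM '' K := by
    rintro ⟨z, hz, h⟩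
    refine hS z hz ?_
    rw [sub_eq_zero.1 (show z.1 - z.2 = 0 from h)]
  have b1 := ((boundOn_moving_succ ha hb ha0 hb0
    (hc.image sumCLM.continuous) h1 k).1).comp_right sumCLM hl
  have b2 := ((boundOn_moving_succ ha hb ha0 hb0
    (hc.image diffCLM.continuous) h2 k).2).comp_right diffCLM hr
  exact (BoundOn.add (hl.comp_right sumCLM) (hr.comp_right diffCLM)
    (fun _ _ => trivial) b1 b2).mono (by linarith)

theorem NullOffZero.tendsto_integral {b : ℝ → ℝ → 𝕜} (hb0 : NullOffZero b) {c d : ℝ}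
    (h : 0 ∉ uIcc c d) : Tendsto (fun ε => ∫ y in c..d, b ε y) (𝓝[>] 0) (𝓝 0) := by
  obtain ⟨C, hC⟩ := hb0 _ isCompact_uIcc h 0 1 zero_le_one
  refine tendsto_of_le_mul_rpow (C := C * |d - c|) one_pos ?_
  filter_upwards [hC] with ε hε
  refine (intervalIntegral.norm_integral_le_of_norm_le_const (C := C * ε ^ (1 : ℝ)) ?_).trans
    (le_of_eq (by ring))
  intro y hy
  simpa using hε y (uIoc_subset_uIcc hy)

/-- Off the origin, the primitive is asymptotic to its value near `±∞`. -/
theorem NullOffZero.tendsto_primitive_sub {b : ℝ → ℝ → 𝕜} (hb : IsSmoothFamily (⊤ : Opens ℝ) b)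
    (hb0 : NullOffZero b) {c d : ℝ} (h : 0 ∉ uIcc c d) :
    Tendsto (fun ε => primitive b ε d - primitive b ε c) (𝓝[>] 0) (𝓝 0) := by
  refine (hb0.tendsto_integral h).congr' ?_
  filter_upwards [eventually_Ioo] with ε hε
  have hi := fun x => (hb.contDiff ⟨hε.1, hε.2.le⟩).continuous.intervalIntegrable (μ := volume) 0 x
  exact (intervalIntegral.integral_interval_sub_left (hi d) (hi c)).symm

theorem primitive_sub_primitive_neg {b : ℝ → ℝ → 𝕜} (hb : IsSmoothFamily (⊤ : Opens ℝ) b) {R : ℝ}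
    {ε : ℝ} (hε : ε ∈ Ioc (0 : ℝ) 1) (h : ∀ x, R < |x| → b ε x = 0) {T : ℝ} (hT : R < T)
    (hT0 : 0 < T) : primitive b ε T - primitive b ε (-T) = ∫ x, b ε x := by
  have hi := fun x => (hb.contDiff hε).continuous.intervalIntegrable (μ := volume) 0 x
  rw [primitive, primitive, intervalIntegral.integral_interval_sub_left (hi T) (hi (-T)),
    intervalIntegral.integral_of_le (by linarith)]
  refine setIntegral_eq_integral_of_forall_compl_eq_zero fun x hx => ?_
  refine h x (hT.trans_le ?_)
  by_contra! hlt
  rw [abs_lt] at hlt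
  exact hx ⟨hlt.1, hlt.2.le⟩

/-- Off the light cone, the free wave is asymptotic to `0`, `M` or `-M`. -/
theorem exists_tendsto_freeWave_sub {a b : ℝ → ℝ → 𝕜} (hb : IsSmoothFamily (⊤ : Opens ℝ) b)
    (ha0 : NullOffZero a) (hb0 : NullOffZero b)
    {R : ℝ} (hR : ∀ ε ∈ Ioc (0 : ℝ) 1, ∀ x, R < |x| → b ε x = 0) {ξ η : ℝ} (hξ : ξ ≠ 0)
    (hη : η ≠ 0) :
    ∃ κ : 𝕜, (κ = 0 ∨ ‖κ‖ = 1) ∧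
      Tendsto (fun ε => leftMoving a b ε ξ + rightMoving a b ε η
        - κ * ((1 / 2 : 𝕜) * ∫ x, b ε x)) (𝓝[>] 0) (𝓝 0) := by
  -- `±T` lie outside the support of every `b ε`, so the primitive jumps between them by exactly the
  -- full integral.
  set T : ℝ := max R 0 + 1
  have hT0 : 0 < T := by positivity
  have hTR : R < T := (le_max_left R 0).trans_lt (lt_add_one _)
  -- Moving `x` to the one of `±T` on its own side of the origin changes the primitive only by an
  -- integral over an interval avoiding `0`.
  have hlim : ∀ x : ℝ, x ≠ 0 → ∃ σ : ℝ, (σ = T ∨ σ = -T) ∧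
      Tendsto (fun ε => primitive b ε x - primitive b ε σ) (𝓝[>] 0) (𝓝 0) := by
    intro x hx
    rcases lt_or_gt_of_ne hx with h | h
    · refine ⟨-T, Or.inr rfl, hb0.tendsto_primitive_sub hb fun h0 => ?_⟩
      exact absurd h0.2 (not_le.2 (max_lt (by linarith) h))
    · refine ⟨T, Or.inl rfl, hb0.tendsto_primitive_sub hb fun h0 => ?_⟩
      exact absurd h0.1 (not_le.2 (lt_min hT0 h))
  have hpt : ∀ x : ℝ, x ≠ 0 → Tendsto (fun ε => a ε x) (𝓝[>] 0) (𝓝 0) := fun x hx =>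
    (ha0.tendstoUniformlyOn (isCompact_singleton (x := x)) (by simpa using hx.symm)).tendsto_at
      (mem_singleton x)
  obtain ⟨σ, hσ, h1⟩ := hlim ξ hξ
  obtain ⟨τ, hτ, h2⟩ := hlim η hη
  -- `κ` is `0` when `ξ` and `η` have the same sign (outside the cone), and `±1` when the signs
  -- differ (in the future or the past of the origin).
  obtain ⟨κ, hκ, hκ'⟩ : ∃ κ : 𝕜, (κ = 0 ∨ ‖κ‖ = 1) ∧ ∀ ε ∈ Ioc (0 : ℝ) 1,
      primitive b ε σ - primitive b ε τ = κ * ∫ x, b ε x := by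
    have key := fun ε hε => primitive_sub_primitive_neg hb (ε := ε) hε (hR ε hε) hTR hT0
    rcases hσ with rfl | rfl <;> rcases hτ with rfl | rfl
    · exact ⟨0, Or.inl rfl, fun ε _ => by simp⟩
    · exact ⟨1, Or.inr (by simp), fun ε hε => by rw [key ε hε, one_mul]⟩
    · exact ⟨-1, Or.inr (by simp), fun ε hε => by rw [← key ε hε]; ring⟩
    · exact ⟨0, Or.inl rfl, fun ε _ => by simp⟩
  refine ⟨κ, hκ, ?_⟩
  have h3 := (((hpt ξ hξ).add (hpt η hη)).add (h1.sub h2)).const_mul (2⁻¹ : 𝕜)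
  simp only [add_zero, sub_zero, mul_zero] at h3
  refine h3.congr' ?_
  filter_upwards [eventually_Ioo] with ε hε
  have := hκ' ε ⟨hε.1, hε.2.le⟩
  simp only [leftMoving, rightMoving, Pi.smul_apply, Pi.add_apply, Pi.sub_apply, smul_eq_mul]
  linear_combination (-2⁻¹ : 𝕜) * this

end FreeWaves

/-! ### Characteristic coordinates and Duhamel's formula. -/

section Duhamel

variable {𝕜 : Type*} [RCLike 𝕜]

/-- The point with characteristic coordinates `x + t = a`, `x - t = b`. -/
def charPoint (a b : ℝ) : ℝ × ℝ := ((a + b) / 2, (a - b) / 2)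

theorem continuous_charPoint : Continuous fun p : ℝ × ℝ => charPoint p.1 p.2 := by
  unfold charPoint
  fun_prop

theorem charPoint_self (a : ℝ) : charPoint a a = (a, 0) := by simp [charPoint]

theorem hasDerivAt_charPoint_left (a b : ℝ) :
    HasDerivAt (fun a => charPoint a b) ((1 / 2, 1 / 2) : ℝ × ℝ) a :=
  (((hasDerivAt_id a).add_const b).div_const 2).prodMk
    (((hasDerivAt_id a).sub_const b).div_const 2)

theorem hasDerivAt_charPoint_right (a b : ℝ) :
    HasDerivAt (fun b => charPoint a b) ((1 / 2, -1 / 2) : ℝ × ℝ) b :=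
  (((hasDerivAt_id b).const_add a).div_const 2).prodMk
    (((hasDerivAt_id b).const_sub a).div_const 2)

theorem fderiv_fderiv_apply {u : ℝ × ℝ → 𝕜} (hu : ContDiff ℝ ∞ u) (z d e : ℝ × ℝ) :
    fderiv ℝ (fun z => fderiv ℝ u z d) z e = fderiv ℝ (fderiv ℝ u) z e d := by
  have h : DifferentiableAt ℝ (fderiv ℝ u) z :=
    (hu.fderiv_right (m := ∞) (by simp)).differentiable (by simp) z
  simp [fderiv_clm_apply h (differentiableAt_const d)]

/-- The mixed derivative in characteristic coordinates is the wave operator. -/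
theorem mixed_characteristic_derivative {u : ℝ × ℝ → 𝕜} (hu : ContDiff ℝ ∞ u) (z : ℝ × ℝ) :
    4 * fderiv ℝ (fderiv ℝ u) z (1 / 2, -1 / 2) (1 / 2, 1 / 2) =
      fderiv ℝ (fderiv ℝ u) z (1, 0) (1, 0) - fderiv ℝ (fderiv ℝ u) z (0, 1) (0, 1) := by
  -- Symmetry of the second derivative cancels the two mixed `x`, `t` terms.
  have hs : IsSymmSndFDerivAt ℝ u z := hu.contDiffAt.isSymmSndFDerivAt
    (by simpa using WithTop.coe_le_coe.2 (le_top : (2 : ℕ∞) ≤ ⊤))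
  have e1 : ((1 / 2, -1 / 2) : ℝ × ℝ) = (1 / 2 : ℝ) • (1, 0) + (-1 / 2 : ℝ) • (0, 1) := by simp
  have e2 : ((1 / 2, 1 / 2) : ℝ × ℝ) = (1 / 2 : ℝ) • (1, 0) + (1 / 2 : ℝ) • (0, 1) := by simp
  have := hs.eq (1, 0) (0, 1)
  rw [e1, e2]
  simp only [map_add, map_smul, add_apply, smul_apply,
    this, RCLike.real_smul_eq_coe_mul]
  push_cast
  ring

theorem continuous_integral_integral {g : ℝ × ℝ → 𝕜} (hg : Continuous g) (η : ℝ) :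
    Continuous fun a => ∫ b in η..a, g (a, b) :=
  intervalIntegral.continuous_parametric_intervalIntegral_of_continuous
    (f := fun a b => g (a, b)) hg continuous_id

/-- D'Alembert's formula with Duhamel's term, in characteristic coordinates. -/
theorem characteristic_formula {u : ℝ × ℝ → 𝕜} (hu : ContDiff ℝ ∞ u) (ξ η : ℝ) :
    u (charPoint ξ η) =
      2⁻¹ * (u (ξ, 0) + ∫ y in 0..ξ, fderiv ℝ u (y, 0) (0, 1)) +
      2⁻¹ * (u (η, 0) - ∫ y in 0..η, fderiv ℝ u (y, 0) (0, 1)) +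
      4⁻¹ * ∫ a in η..ξ, ∫ b in η..a,
        (fderiv ℝ (fun z => fderiv ℝ u z (0, 1)) (charPoint a b) (0, 1) -
          fderiv ℝ (fun z => fderiv ℝ u z (1, 0)) (charPoint a b) (1, 0)) := by
  have hu1 : ContDiff ℝ ∞ (fderiv ℝ u) := hu.fderiv_right (by simp)
  have hu2 : ContDiff ℝ ∞ (fderiv ℝ (fderiv ℝ u)) := hu1.fderiv_right (by simp)
  have hc1 := hu1.continuous
  have hc2 := hu2.continuous
  have hcP := continuous_charPoint
  -- `A` is the derivative of `u` in the first characteristic coordinate. Differentiating it in the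
  -- second one gives `-1/4` of the wave operator, so the inner integral is evaluated by the
  -- fundamental theorem of calculus, from the diagonal `t = 0`.
  set A : ℝ × ℝ → 𝕜 := fun z => fderiv ℝ u z (1 / 2, 1 / 2) with hA
  have hAc : Continuous A := by fun_prop
  have hA1 : ContDiff ℝ ∞ A := hu1.clm_apply contDiff_const
  have hinner : ∀ a, (∫ b in η..a,
        (fderiv ℝ (fun z => fderiv ℝ u z (0, 1)) (charPoint a b) (0, 1) -
          fderiv ℝ (fun z => fderiv ℝ u z (1, 0)) (charPoint a b) (1, 0)))
      = 4 * (A (charPoint a η) - A (a, 0)) := by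
    intro a
    have hd : ∀ b ∈ uIcc η a, HasDerivAt (fun b => -4 * A (charPoint a b))
        (fderiv ℝ (fun z => fderiv ℝ u z (0, 1)) (charPoint a b) (0, 1) -
          fderiv ℝ (fun z => fderiv ℝ u z (1, 0)) (charPoint a b) (1, 0)) b := by
      intro b _
      have h := ((hA1.differentiable (by simp) (charPoint a b)).hasFDerivAt.comp_hasDerivAt b
        (hasDerivAt_charPoint_right a b)).const_mul (-4 : 𝕜)
      refine h.congr_deriv ?_
      rw [hA, fderiv_fderiv_apply hu, fderiv_fderiv_apply hu, fderiv_fderiv_apply hu]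
      linear_combination -mixed_characteristic_derivative hu (charPoint a b)
    rw [intervalIntegral.integral_eq_sub_of_hasDerivAt hd, charPoint_self]
    · ring
    · refine Continuous.intervalIntegrable ?_ _ _
      simp only [fderiv_fderiv_apply hu]
      have : Continuous fun b => charPoint a b := hcP.comp (Continuous.prodMk_right a)
      fun_prop
  simp only [hinner]
  have i1 : Continuous fun a => A (charPoint a η) :=
    hAc.comp (hcP.comp (Continuous.prodMk_left η))
  have i2 : Continuous fun a : ℝ => A (a, 0) := hAc.comp (Continuous.prodMk_left 0)
  rw [intervalIntegral.integral_const_mul, intervalIntegral.integral_sub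
    (i1.intervalIntegrable _ _) (i2.intervalIntegrable _ _)]
  have d1 : ∀ a ∈ uIcc η ξ, HasDerivAt (fun a => u (charPoint a η)) (A (charPoint a η)) a :=
    fun a _ => (hu.differentiable (by simp) (charPoint a η)).hasFDerivAt.comp_hasDerivAt a
      (hasDerivAt_charPoint_left a η)
  have hct : Continuous fun y : ℝ => fderiv ℝ u (y, 0) (0, 1) := by fun_prop
  -- On the diagonal `A` equals `(∂_x u + ∂_t u) / 2`, whose primitive is the left-moving profile of
  -- the initial data. The difference of its values at `ξ` and `η`, together with `u (η, 0)`, makes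
  -- up both d'Alembert profiles.
  have d2 : ∀ a ∈ uIcc η ξ, HasDerivAt
      (fun a => 2⁻¹ * (u (a, 0) + ∫ y in 0..a, fderiv ℝ u (y, 0) (0, 1))) (A (a, 0)) a := by
    intro a _
    have k1 : HasDerivAt (fun a : ℝ => u (a, 0)) (fderiv ℝ u (a, 0) (1, 0)) a :=
      (hu.differentiable (by simp) (a, 0)).hasFDerivAt.comp_hasDerivAt a
        ((hasDerivAt_id a).prodMk (hasDerivAt_const a 0))
    have k2 := (k1.add (hct.integral_hasStrictDerivAt 0 a).hasDerivAt).const_mul (2⁻¹ : 𝕜)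
    refine k2.congr_deriv ?_
    have e2 : ((1 / 2, 1 / 2) : ℝ × ℝ) = (1 / 2 : ℝ) • (1, 0) + (1 / 2 : ℝ) • (0, 1) := by simp
    simp only [hA, e2, map_add, map_smul, RCLike.real_smul_eq_coe_mul]
    push_cast
    ring
  rw [intervalIntegral.integral_eq_sub_of_hasDerivAt d1 (i1.intervalIntegrable _ _),
    intervalIntegral.integral_eq_sub_of_hasDerivAt d2 (i2.intervalIntegrable _ _),
    charPoint_self]
  ring

end Duhamel

/-! ### A Gronwall inequality on characteristic triangles. -/

section Gronwall

/-- Each integration of the exponential weight gains a factor `1 / lam`; the term `-1 / lam` from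
the base point is dropped. The absolute values cover both orientations, hence both signs of `t`. -/
theorem lintegral_uIoc_exp_le {lam : ℝ} (hl : 0 < lam) (c d : ℝ) :
    ∫⁻ s in uIoc c d, ENNReal.ofReal (Real.exp (lam * |s - c|)) ≤
      ENNReal.ofReal (Real.exp (lam * |d - c|) / lam) := by
  have hc : Continuous fun s : ℝ => Real.exp (lam * |s - c|) := by fun_prop
  rw [← ofReal_integral_eq_lintegral_ofReal (hc.integrableOn_uIoc)
    (ae_of_all _ fun _ => (Real.exp_pos _).le)]
  refine ENNReal.ofReal_le_ofReal ?_
  rcases le_total c d with h | h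
  · rw [uIoc_of_le h, ← intervalIntegral.integral_of_le h]
    have e : ∫ s in c..d, Real.exp (lam * |s - c|) = ∫ s in c..d, Real.exp (lam * (s - c)) := by
      refine intervalIntegral.integral_congr fun s hs => ?_
      rw [uIcc_of_le h] at hs
      simp only [abs_of_nonneg (sub_nonneg.2 hs.1)]
    have hd : ∀ s ∈ uIcc c d, HasDerivAt (fun s => Real.exp (lam * (s - c)) / lam)
        (Real.exp (lam * (s - c))) s := fun s _ => by
      have := ((((hasDerivAt_id s).sub_const c).const_mul lam).exp).div_const lam
      refine this.congr_deriv ?_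
      simp only [id]
      field_simp
    rw [e, intervalIntegral.integral_eq_sub_of_hasDerivAt hd
      (Continuous.intervalIntegrable (by fun_prop) _ _), abs_of_nonneg (sub_nonneg.2 h)]
    simp only [sub_self, mul_zero, Real.exp_zero]
    have : 0 < 1 / lam := by positivity
    linarith
  · rw [uIoc_of_ge h, ← intervalIntegral.integral_of_le h]
    have e : ∫ s in d..c, Real.exp (lam * |s - c|) = ∫ s in d..c, Real.exp (lam * (c - s)) := by
      refine intervalIntegral.integral_congr fun s hs => ?_
      rw [uIcc_of_le h] at hs
      simp only [abs_of_nonpos (sub_nonpos.2 hs.2), neg_sub]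
    have hd : ∀ s ∈ uIcc d c, HasDerivAt (fun s => -(Real.exp (lam * (c - s)) / lam))
        (Real.exp (lam * (c - s))) s := fun s _ => by
      have := (((((hasDerivAt_id s).const_sub c).const_mul lam).exp).div_const lam).neg
      refine this.congr_deriv ?_
      simp only [id]
      field_simp
    rw [e, intervalIntegral.integral_eq_sub_of_hasDerivAt hd
      (Continuous.intervalIntegrable (by fun_prop) _ _), abs_of_nonpos (sub_nonpos.2 h), neg_sub]
    simp only [sub_self, mul_zero, Real.exp_zero]
    have : 0 < 1 / lam := by positivity
    linarith

/-- The square `[-R, R]²` in characteristic coordinates. -/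
def square (R : ℝ) : Set (ℝ × ℝ) := Icc (-R) R ×ˢ Icc (-R) R

theorem isCompact_square (R : ℝ) : IsCompact (square R) := isCompact_Icc.prod isCompact_Icc

/-- Both coordinates of points of the triangle lie between `η` and `ξ`, so squares contain the
domains of dependence of their points. -/
theorem mem_square_of_mem_uIoc {R ξ η a b : ℝ} (h : (ξ, η) ∈ square R) (ha : a ∈ uIoc η ξ)
    (hb : b ∈ uIoc η a) : (a, b) ∈ square R := by
  have h1 : a ∈ Icc (-R) R := (uIcc_subset_Icc h.2 h.1) (uIoc_subset_uIcc ha)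
  exact ⟨h1, (uIcc_subset_Icc h.2 h1) (uIoc_subset_uIcc hb)⟩

/-- A Gronwall inequality for integrals over characteristic triangles. -/
theorem le_of_le_add_characteristic_integral {R L c : ℝ} (hL : 0 ≤ L) (hc : 0 ≤ c)
    {d : ℝ × ℝ → ℝ} (hd : ContinuousOn d (square R)) (hd0 : ∀ z, 0 ≤ d z)
    (h : ∀ ξ η, (ξ, η) ∈ square R → ENNReal.ofReal (d (ξ, η)) ≤ ENNReal.ofReal c +
      ENNReal.ofReal L * ∫⁻ a in uIoc η ξ, ∫⁻ b in uIoc η a, ENNReal.ofReal (d (a, b)))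
    {z : ℝ × ℝ} (hz : z ∈ square R) : d z ≤ 2 * c * Real.exp ((L + 1) * (2 * R)) := by
  have hl : 0 < L + 1 := by positivity
  -- The inequality is used only at a maximum point of `d` weighted by `exp (-(L + 1) |ξ - η|)`;
  -- there the integral term can be absorbed in the left side.
  obtain ⟨z₀, hz₀, hmax⟩ := (isCompact_square R).exists_isMaxOn ⟨z, hz⟩
    (f := fun z : ℝ × ℝ => d z * Real.exp (-((L + 1) * |z.2 - z.1|)))
    (hd.mul (Continuous.continuousOn (by fun_prop)))
  obtain ⟨ξ, η⟩ := z₀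
  set m : ℝ := d (ξ, η) * Real.exp (-((L + 1) * |η - ξ|)) with hm
  have hm0 : 0 ≤ m := mul_nonneg (hd0 _) (Real.exp_pos _).le
  have hdm : ∀ p ∈ square R, d p ≤ m * Real.exp ((L + 1) * |p.2 - p.1|) := fun p hp => by
    have h1 : d p * Real.exp (-((L + 1) * |p.2 - p.1|)) ≤ m := hmax hp
    rwa [Real.exp_neg, ← div_eq_mul_inv, div_le_iff₀ (Real.exp_pos _)] at h1
  have hm1 : d (ξ, η) = m * Real.exp ((L + 1) * |ξ - η|) := by
    rw [hm, mul_assoc, ← Real.exp_add, abs_sub_comm ξ η]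
    simp
  have key : ENNReal.ofReal (d (ξ, η)) ≤ ENNReal.ofReal (c + 2⁻¹ * d (ξ, η)) := by
    refine (h ξ η hz₀).trans ?_
    rw [ENNReal.ofReal_add hc (mul_nonneg (by norm_num) (hd0 _))]
    gcongr
    calc ENNReal.ofReal L * ∫⁻ a in uIoc η ξ, ∫⁻ b in uIoc η a, ENNReal.ofReal (d (a, b))
        ≤ ENNReal.ofReal L * ∫⁻ a in uIoc η ξ,
            ENNReal.ofReal (m / (L + 1)) * ENNReal.ofReal (Real.exp ((L + 1) * |a - η|)) := by
          gcongr ENNReal.ofReal L * ?_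
          refine setLIntegral_mono' (measurableSet_uIoc (a := η) (b := ξ)) fun a ha => ?_
          calc ∫⁻ b in uIoc η a, ENNReal.ofReal (d (a, b))
              ≤ ∫⁻ b in uIoc η a,
                  ENNReal.ofReal m * ENNReal.ofReal (Real.exp ((L + 1) * |b - a|)) := by
                refine setLIntegral_mono' (measurableSet_uIoc (a := η) (b := a)) fun b hb => ?_
                rw [← ENNReal.ofReal_mul hm0]
                exact ENNReal.ofReal_le_ofReal (hdm (a, b) (mem_square_of_mem_uIoc hz₀ ha hb))
            _ ≤ ENNReal.ofReal m * ENNReal.ofReal (Real.exp ((L + 1) * |η - a|) / (L + 1)) := by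
                rw [lintegral_const_mul' _ _ ENNReal.ofReal_ne_top, uIoc_comm]
                gcongr
                exact lintegral_uIoc_exp_le hl a η
            _ = _ := by
                rw [← ENNReal.ofReal_mul hm0, ← ENNReal.ofReal_mul (by positivity),
                  abs_sub_comm η a]
                congr 1
                ring
      _ ≤ ENNReal.ofReal L * (ENNReal.ofReal (m / (L + 1)) *
            ENNReal.ofReal (Real.exp ((L + 1) * |ξ - η|) / (L + 1))) := by
          rw [lintegral_const_mul' _ _ ENNReal.ofReal_ne_top]
          gcongr
          exact lintegral_uIoc_exp_le hl η ξ
      _ ≤ ENNReal.ofReal (2⁻¹ * d (ξ, η)) := by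
          rw [← ENNReal.ofReal_mul (by positivity), ← ENNReal.ofReal_mul hL]
          refine ENNReal.ofReal_le_ofReal ?_
          have e : L * (m / (L + 1) * (Real.exp ((L + 1) * |ξ - η|) / (L + 1))) =
              L / (L + 1) ^ 2 * d (ξ, η) := by
            rw [hm1]
            field_simp
          rw [e]
          refine mul_le_mul_of_nonneg_right ?_ (hd0 _)
          rw [div_le_iff₀ (by positivity)]
          -- Two integrations of the weight give the factor `L / (L + 1) ^ 2`, which is at most `1 /
          -- 2`; absorbing it costs the factor `2` in front of `c`.
          nlinarith [sq_nonneg L]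
  rw [ENNReal.ofReal_le_ofReal_iff (add_nonneg hc (mul_nonneg (by norm_num) (hd0 _)))] at key
  have hm2 : m ≤ 2 * c := by
    have : m ≤ d (ξ, η) := mul_le_of_le_one_right (hd0 _)
      (Real.exp_le_one_iff.2 (neg_nonpos.2 (by positivity)))
    linarith
  refine (hdm z hz).trans ?_
  have h2 : |z.2 - z.1| ≤ 2 * R := by
    obtain ⟨⟨h1, h2⟩, h3, h4⟩ := hz
    rw [abs_le]
    constructor <;> linarith
  gcongr

end Gronwall

/-! ### The uniform Cauchy property of solutions of the integral equation. -/

section CauchyEstimate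

variable {𝕜 : Type*} [RCLike 𝕜]

/-- The variable domain of integration is absorbed in the indicator of a measurable subset of the
plane, so Tonelli's theorem applies. -/
theorem measurable_lintegral_uIoc {g : ℝ × ℝ → ENNReal} (hg : Measurable g) (η : ℝ) :
    Measurable fun a => ∫⁻ b in uIoc η a, g (a, b) := by
  have hs : MeasurableSet {p : ℝ × ℝ | p.2 ∈ uIoc η p.1} := by
    simp only [uIoc, mem_Ioc]
    have h1 : Measurable fun p : ℝ × ℝ => min η p.1 := by fun_prop
    have h2 : Measurable fun p : ℝ × ℝ => max η p.1 := by fun_prop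
    exact (measurableSet_lt h1 measurable_snd).inter (measurableSet_le measurable_snd h2)
  have h := (hg.indicator hs).lintegral_prod_right' (ν := volume)
  convert h using 2 with a
  rw [← lintegral_indicator (measurableSet_uIoc (a := η) (b := a))]
  rfl

/-- Enlarging triangles to the whole square makes error terms independent of `(ξ, η)`. Almost
everywhere measurability suffices, as is needed for the `L¹` limit `w`. -/
theorem lintegral_characteristic_le {R ξ η : ℝ} (h : (ξ, η) ∈ square R) {g : ℝ × ℝ → ENNReal}
    (hg : AEMeasurable g (volume.restrict (square R))) :
    ∫⁻ a in uIoc η ξ, ∫⁻ b in uIoc η a, g (a, b) ≤ ∫⁻ z in square R, g z := by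
  have hQ : (volume.restrict (square R) : Measure (ℝ × ℝ)) =
      (volume.restrict (Icc (-R) R)).prod (volume.restrict (Icc (-R) R)) :=
    (Measure.prod_restrict _ _).symm
  rw [hQ] at hg ⊢
  rw [lintegral_prod _ hg]
  have hξ : uIoc η ξ ⊆ Icc (-R) R := uIoc_subset_uIcc.trans (uIcc_subset_Icc h.2 h.1)
  calc ∫⁻ a in uIoc η ξ, ∫⁻ b in uIoc η a, g (a, b)
      ≤ ∫⁻ a in uIoc η ξ, ∫⁻ b in Icc (-R) R, g (a, b) := by
        refine setLIntegral_mono' (measurableSet_uIoc (a := η) (b := ξ)) fun a ha => ?_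
        exact lintegral_mono_set (uIoc_subset_uIcc.trans (uIcc_subset_Icc h.2 (hξ ha)))
    _ ≤ _ := lintegral_mono_set hξ

theorem enorm_intervalIntegral_le (g : ℝ → 𝕜) (c d : ℝ) :
    ‖∫ s in c..d, g s‖ₑ ≤ ∫⁻ s in uIoc c d, ‖g s‖ₑ := by
  rw [← ofReal_norm, intervalIntegral.norm_intervalIntegral_eq, ofReal_norm]
  exact enorm_integral_le_lintegral_enorm _

/-- Differences of characteristic integrals. -/
theorem enorm_characteristic_integral_sub_le {g₁ g₂ : ℝ × ℝ → 𝕜} (h₁ : Continuous g₁)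
    (h₂ : Continuous g₂) (ξ η : ℝ) :
    ‖(4⁻¹ : 𝕜) * (∫ a in η..ξ, ∫ b in η..a, g₁ (a, b)) -
      4⁻¹ * ∫ a in η..ξ, ∫ b in η..a, g₂ (a, b)‖ₑ ≤
      ∫⁻ a in uIoc η ξ, ∫⁻ b in uIoc η a, ‖g₁ (a, b) - g₂ (a, b)‖ₑ := by
  have e : ∫ a in η..ξ, ∫ b in η..a, (g₁ (a, b) - g₂ (a, b)) =
      (∫ a in η..ξ, ∫ b in η..a, g₁ (a, b)) - ∫ a in η..ξ, ∫ b in η..a, g₂ (a, b) := by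
    rw [← intervalIntegral.integral_sub
      ((continuous_integral_integral h₁ η).intervalIntegrable _ _)
      ((continuous_integral_integral h₂ η).intervalIntegrable _ _)]
    refine intervalIntegral.integral_congr fun a _ => ?_
    exact intervalIntegral.integral_sub
      ((h₁.comp (Continuous.prodMk_right a)).intervalIntegrable _ _)
      ((h₂.comp (Continuous.prodMk_right a)).intervalIntegrable _ _)
  rw [← mul_sub, ← e, enorm_mul]
  have h4 : ‖(4⁻¹ : 𝕜)‖ₑ ≤ 1 := by
    rw [← ofReal_norm, ← ENNReal.ofReal_one]
    refine ENNReal.ofReal_le_ofReal ?_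
    rw [norm_inv, RCLike.norm_ofNat]
    norm_num
  refine (mul_le_of_le_one_left zero_le h4).trans ((enorm_intervalIntegral_le _ _ _).trans ?_)
  exact lintegral_mono fun a => enorm_intervalIntegral_le _ _ _

/-- With `f` bounded, this bounds the nonlinear part independently of the size of the data. -/
theorem norm_characteristic_integral_le {R B ξ η : ℝ} (hR : (ξ, η) ∈ square R) {g : ℝ × ℝ → 𝕜}
    (hB : 0 ≤ B) (hg : ∀ z ∈ square R, ‖g z‖ ≤ B) :
    ‖(4⁻¹ : 𝕜) * ∫ a in η..ξ, ∫ b in η..a, g (a, b)‖ ≤ B * (2 * R) * (2 * R) := by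
  have hlen : ∀ a, (a, η) ∈ square R → |a - η| ≤ 2 * R := by
    rintro a ⟨⟨h1, h2⟩, h3, h4⟩
    rw [abs_le]
    constructor <;> linarith
  have hR0 : 0 ≤ 2 * R := (abs_nonneg _).trans (hlen ξ hR)
  have h1 : ∀ a ∈ uIoc η ξ, ‖∫ b in η..a, g (a, b)‖ ≤ B * (2 * R) := fun a ha => by
    refine (intervalIntegral.norm_integral_le_of_norm_le_const (C := B) fun b hb =>
      hg _ (mem_square_of_mem_uIoc hR ha hb)).trans ?_
    have : (a, η) ∈ square R := ⟨uIcc_subset_Icc hR.2 hR.1 (uIoc_subset_uIcc ha), hR.2⟩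
    gcongr
    exact hlen a this
  rw [norm_mul]
  have h4 : ‖(4⁻¹ : 𝕜)‖ ≤ 1 := by
    rw [norm_inv, RCLike.norm_ofNat]
    norm_num
  refine (mul_le_of_le_one_left (norm_nonneg _) h4).trans ?_
  refine (intervalIntegral.norm_integral_le_of_norm_le_const h1).trans ?_
  gcongr
  exact hlen ξ hR

/-- Along the filter, the values of `f` on shifted arguments `y + v i + h i` with `h` bounded are
asymptotically `L`-Lipschitz in `h`, if `v i` converges, or if `v i` is infinitely large and `f` has
a limit at infinity. -/
theorem tendsto_lipschitz_defect {ι : Type*} {l : Filter ι} {f : 𝕜 → 𝕜} {L : NNReal}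
    (hf : LipschitzWith L f) {v h : ι → 𝕜} {C : ℝ} (hC : ∀ᶠ i in l, ‖h i‖ ≤ C) (y : 𝕜)
    (hv : (∃ c, Tendsto v l (𝓝 c)) ∨ (Tendsto (fun i => ‖v i‖) l atTop ∧
      ∃ c, Tendsto f (comap norm atTop) (𝓝 c))) :
    Tendsto (fun p : ι × ι => ENNReal.ofReal
      (‖f (y + v p.1 + h p.1) - f (y + v p.2 + h p.2)‖ - L * ‖h p.1 - h p.2‖)) (l ×ˢ l) (𝓝 0) := by
  obtain ⟨φ, hφ, hle⟩ : ∃ φ : ι × ι → ℝ, Tendsto φ (l ×ˢ l) (𝓝 0) ∧ ∀ p,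
      ‖f (y + v p.1 + h p.1) - f (y + v p.2 + h p.2)‖ - L * ‖h p.1 - h p.2‖ ≤ φ p := by
    rcases hv with ⟨c, hc⟩ | ⟨hv, c, hc⟩
    · refine ⟨fun p => L * ‖v p.1 - v p.2‖, ?_, fun p => ?_⟩
      · have := (((hc.comp tendsto_fst).sub (hc.comp tendsto_snd)).norm).const_mul (L : ℝ)
        simpa using this
      · have h1 := hf.norm_sub_le (y + v p.1 + h p.1) (y + v p.2 + h p.2)
        have h2 : ‖y + v p.1 + h p.1 - (y + v p.2 + h p.2)‖ ≤ ‖v p.1 - v p.2‖ + ‖h p.1 - h p.2‖ := by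
          rw [show y + v p.1 + h p.1 - (y + v p.2 + h p.2) =
            (v p.1 - v p.2) + (h p.1 - h p.2) by ring]
          exact norm_add_le _ _
        have h3 := mul_le_mul_of_nonneg_left h2 L.coe_nonneg
        linarith
    · have hinf : Tendsto (fun i => f (y + v i + h i)) l (𝓝 c) := by
        refine hc.comp (tendsto_comap_iff.2 ?_)
        -- A bounded perturbation of an infinitely large argument is infinitely large, whatever its
        -- direction.
        refine tendsto_atTop_mono' l ?_ (tendsto_atTop_add_const_right l (-(‖y‖ + C)) hv)
        filter_upwards [hC] with i hi
        have h1 := norm_sub_norm_le (v i) (-(y + h i))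
        rw [norm_neg, show v i - -(y + h i) = y + v i + h i by ring] at h1
        have h2 := norm_add_le y (h i)
        simp only [Function.comp_apply]
        linarith
      refine ⟨fun p => ‖f (y + v p.1 + h p.1) - f (y + v p.2 + h p.2)‖, ?_, fun p => ?_⟩
      · have := ((hinf.comp tendsto_fst).sub (hinf.comp (tendsto_snd (f := l) (g := l)))).norm
        simpa using this
      · have : 0 ≤ L * ‖h p.1 - h p.2‖ := by positivity
        linarith
  have h0 : Tendsto (fun p => ENNReal.ofReal (φ p)) (l ×ˢ l) (𝓝 0) := by
    simpa using ENNReal.tendsto_ofReal hφ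
  exact tendsto_of_tendsto_of_tendsto_of_le_of_le tendsto_const_nhds h0 (fun _ => zero_le)
    fun p => ENNReal.ofReal_le_ofReal (hle p)

/-- Solutions of the integral equation for the semilinear wave equation in characteristic
coordinates, with forcing by a convergent part `ρ` and a part `v` that converges pointwise or is
infinitely large, form a uniform Cauchy family. -/
theorem uniformCauchySeqOn_of_integral_equation {ι : Type*} {l : Filter ι}
    [l.IsCountablyGenerated] {f : 𝕜 → 𝕜} {L : NNReal} (hf : LipschitzWith L f) {B : ℝ}
    (hB : ∀ y, ‖f y‖ ≤ B) {R : ℝ} {ρ v n h : ι → ℝ × ℝ → 𝕜} {w : ℝ × ℝ → 𝕜}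
    (hcont : ∀ᶠ i in l, Continuous (ρ i) ∧ Continuous (v i) ∧ Continuous (n i) ∧ Continuous (h i))
    (hw : AEStronglyMeasurable w (volume.restrict (square R)))
    (hρ : Tendsto (fun i => ∫⁻ z in square R, ‖ρ i z - w z‖ₑ) l (𝓝 0))
    (hv : ∀ᵐ z : ℝ × ℝ, (∃ c, Tendsto (fun i => v i z) l (𝓝 c)) ∨
      (Tendsto (fun i => ‖v i z‖) l atTop ∧ ∃ c, Tendsto f (comap norm atTop) (𝓝 c)))
    (hn : TendstoUniformlyOn n 0 l (square R))
    (hh : ∀ᶠ i in l, ∀ ξ η, h i (ξ, η) = 4⁻¹ * ∫ a in η..ξ, ∫ b in η..a,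
      (f (ρ i (a, b) + v i (a, b) + h i (a, b)) + n i (a, b))) :
    UniformCauchySeqOn h l (square R) := by
  have hQm : MeasurableSet (square R) := measurableSet_Icc.prod measurableSet_Icc
  have hQf : volume (square R) ≠ ⊤ := (isCompact_square R).measure_ne_top
  have hB0 : 0 ≤ B := (norm_nonneg _).trans (hB 0)
  -- `B` bounds `f`, and `1` eventually bounds the uniformly small `n`.
  have hbdd : ∀ᶠ i in l, ∀ z ∈ square R, ‖h i z‖ ≤ (B + 1) * (2 * R) * (2 * R) := by
    rw [Metric.tendstoUniformlyOn_iff] at hn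
    filter_upwards [hh, hn 1 one_pos] with i h1 h2
    rintro ⟨ξ, η⟩ hz
    rw [h1 ξ η]
    refine norm_characteristic_integral_le hz (g := fun z => f (ρ i z + v i z + h i z) + n i z)
      (by positivity) fun p hp => (norm_add_le _ _).trans (add_le_add (hB _) ?_)
    simpa using (h2 p hp).le
  -- The defect is taken at the fixed limit `w`, since `ρ i` is known to converge only in `L¹` and
  -- not pointwise.
  set e : ι × ι → ℝ × ℝ → ENNReal := fun p z => ENNReal.ofReal
    (‖f (w z + v p.1 z + h p.1 z) - f (w z + v p.2 z + h p.2 z)‖ - L * ‖h p.1 z - h p.2 z‖) with he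
  have hcont2 := hcont.prod_mk hcont
  have hem : ∀ᶠ p in l ×ˢ l, AEMeasurable (e p) (volume.restrict (square R)) := by
    filter_upwards [hcont2] with p hp
    obtain ⟨⟨-, c1, -, c2⟩, -, c3, -, c4⟩ := hp
    have m1 : AEMeasurable w (volume.restrict (square R)) := hw.aemeasurable
    have m2 : Measurable f := hf.continuous.measurable
    have m3 : Measurable (v p.1) := c1.measurable
    have m4 : Measurable (h p.1) := c2.measurable
    have m5 : Measurable (v p.2) := c3.measurable
    have m6 : Measurable (h p.2) := c4.measurable
    fun_prop
  -- Dominated convergence: the defects are at most `2B` and tend to zero almost everywhere on the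
  -- square.
  have he0 : Tendsto (fun p => ∫⁻ z in square R, e p z) (l ×ˢ l) (𝓝 0) := by
    have := tendsto_lintegral_filter_of_dominated_convergence' (l := l ×ˢ l)
      (μ := volume.restrict (square R)) (F := e) (f := 0) (fun _ => ENNReal.ofReal (B + B)) hem
      (Eventually.of_forall fun p => ae_of_all _ fun z => ENNReal.ofReal_le_ofReal ?_) ?_ ?_
    · simpa using this
    · have h1 := norm_sub_le (f (w z + v p.1 z + h p.1 z)) (f (w z + v p.2 z + h p.2 z))
      have h2 : 0 ≤ L * ‖h p.1 z - h p.2 z‖ := by positivity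
      linarith [hB (w z + v p.1 z + h p.1 z), hB (w z + v p.2 z + h p.2 z)]
    · simpa using ENNReal.mul_ne_top ENNReal.ofReal_ne_top hQf
    · filter_upwards [ae_restrict_of_ae hv, ae_restrict_mem hQm] with z hz hzQ
      exact tendsto_lipschitz_defect (v := fun i => v i z) (h := fun i => h i z) hf
        (hbdd.mono fun i hi => hi z hzQ) (w z) hz
  have hn0 : Tendsto (fun i => ∫⁻ z in square R, ‖n i z‖ₑ) l (𝓝 0) := by
    simpa using tendsto_setLIntegral_enorm_of_tendstoUniformlyOn hQf hn hQm
  set c : ι × ι → ENNReal := fun p =>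
    L * (∫⁻ z in square R, ‖ρ p.1 z - w z‖ₑ) + L * (∫⁻ z in square R, ‖ρ p.2 z - w z‖ₑ) +
      (∫⁻ z in square R, e p z) + (∫⁻ z in square R, ‖n p.1 z‖ₑ) +
      ∫⁻ z in square R, ‖n p.2 z‖ₑ with hcdef
  have hc0 : Tendsto c (l ×ˢ l) (𝓝 0) := by
    have k1 := ENNReal.Tendsto.const_mul hρ (Or.inr (ENNReal.coe_ne_top (r := L)))
    have := ((((k1.comp tendsto_fst).add (k1.comp tendsto_snd)).add he0).add
      (hn0.comp tendsto_fst)).add (hn0.comp (tendsto_snd (f := l)))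
    simpa using this
  -- The difference of two integral equations satisfies the Gronwall inequality with the constant `c
  -- p`, which does not depend on the point. Comparing two parameters avoids the need for a limit
  -- equation.
  have hmain : ∀ᶠ p in l ×ˢ l, ∀ z ∈ square R,
      ‖h p.1 z - h p.2 z‖ ≤ 2 * (c p).toReal * Real.exp ((L + 1) * (2 * R)) := by
    filter_upwards [hcont2, hh.prod_mk hh, hem, hc0.eventually_lt_const ENNReal.zero_lt_top]
      with p hp hhp hemp hcp z hz
    obtain ⟨⟨cρ, cv, cn, ch⟩, cρ', cv', cn', ch'⟩ := hp
    refine le_of_le_add_characteristic_integral (d := fun z => ‖h p.1 z - h p.2 z‖) L.coe_nonneg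
      ENNReal.toReal_nonneg (ch.sub ch').norm.continuousOn (fun _ => norm_nonneg _) ?_ hz
    intro ξ η hξη
    simp only [ofReal_norm, ENNReal.ofReal_coe_nnreal]
    rw [ENNReal.ofReal_toReal hcp.ne, hhp.1 ξ η, hhp.2 ξ η]
    have hfc := hf.continuous
    refine (enorm_characteristic_integral_sub_le
      (g₁ := fun z => f (ρ p.1 z + v p.1 z + h p.1 z) + n p.1 z)
      (g₂ := fun z => f (ρ p.2 z + v p.2 z + h p.2 z) + n p.2 z)
      (by fun_prop) (by fun_prop) ξ η).trans ?_
    set F : ℝ × ℝ → ENNReal := fun z =>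
      L * ‖ρ p.1 z - w z‖ₑ + L * ‖ρ p.2 z - w z‖ₑ + e p z + ‖n p.1 z‖ₑ + ‖n p.2 z‖ₑ with hF
    set D : ℝ × ℝ → ENNReal := fun z => L * ‖h p.1 z - h p.2 z‖ₑ with hD
    have hDm : Measurable D := ((ch.sub ch').enorm.measurable).const_mul _
    have hwm : AEMeasurable w (volume.restrict (square R)) := hw.aemeasurable
    have m1 : AEMeasurable (fun z => L * ‖ρ p.1 z - w z‖ₑ) (volume.restrict (square R)) :=
      ((cρ.measurable.aemeasurable.sub hwm).enorm).const_mul _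
    have m2 : AEMeasurable (fun z => L * ‖ρ p.2 z - w z‖ₑ) (volume.restrict (square R)) :=
      ((cρ'.measurable.aemeasurable.sub hwm).enorm).const_mul _
    have m3 : AEMeasurable (fun z => ‖n p.1 z‖ₑ) (volume.restrict (square R)) :=
      cn.enorm.measurable.aemeasurable
    have m12 := m1.fun_add m2
    have m123 := m12.fun_add hemp
    have m1234 := m123.fun_add m3
    have hFm : AEMeasurable F (volume.restrict (square R)) :=
      m1234.add cn'.enorm.measurable.aemeasurable
    have hFc : ∫⁻ z in square R, F z = c p := by
      rw [hF, hcdef]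
      simp only
      rw [lintegral_add_left' m1234, lintegral_add_left' m123, lintegral_add_left' m12,
        lintegral_add_left' m1, lintegral_const_mul' _ _ ENNReal.coe_ne_top,
        lintegral_const_mul' _ _ ENNReal.coe_ne_top]
    -- Replacing `ρ` by `w` in both arguments costs `L` times the distance; what remains is at most
    -- the defect plus `L` times the difference of the `h`'s.
    have hpt : ∀ z, ‖f (ρ p.1 z + v p.1 z + h p.1 z) + n p.1 z -
        (f (ρ p.2 z + v p.2 z + h p.2 z) + n p.2 z)‖ₑ ≤ F z + D z := by
      intro z
      have hLip : ∀ y y', ‖f y - f y'‖ₑ ≤ L * ‖y - y'‖ₑ := fun y y' => by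
        simpa [edist_eq_enorm_sub] using hf y y'
      have t1 := hLip (ρ p.1 z + v p.1 z + h p.1 z) (w z + v p.1 z + h p.1 z)
      have t2 := hLip (ρ p.2 z + v p.2 z + h p.2 z) (w z + v p.2 z + h p.2 z)
      rw [show ρ p.1 z + v p.1 z + h p.1 z - (w z + v p.1 z + h p.1 z) = ρ p.1 z - w z by ring]
        at t1
      rw [show ρ p.2 z + v p.2 z + h p.2 z - (w z + v p.2 z + h p.2 z) = ρ p.2 z - w z by ring]
        at t2
      have t3 : ‖f (w z + v p.1 z + h p.1 z) - f (w z + v p.2 z + h p.2 z)‖ₑ ≤ e p z + D z := by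
        rw [he, hD]
        simp only [← ofReal_norm]
        rw [← ENNReal.ofReal_coe_nnreal, ← ENNReal.ofReal_mul L.coe_nonneg]
        refine le_trans (ENNReal.ofReal_le_ofReal ?_) ENNReal.ofReal_add_le
        linarith
      calc _ = ‖(f (ρ p.1 z + v p.1 z + h p.1 z) - f (w z + v p.1 z + h p.1 z)) -
            (f (ρ p.2 z + v p.2 z + h p.2 z) - f (w z + v p.2 z + h p.2 z)) +
            (f (w z + v p.1 z + h p.1 z) - f (w z + v p.2 z + h p.2 z)) +
            n p.1 z - n p.2 z‖ₑ := by
            congr 1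
            ring
        _ ≤ L * ‖ρ p.1 z - w z‖ₑ + L * ‖ρ p.2 z - w z‖ₑ + (e p z + D z) + ‖n p.1 z‖ₑ +
            ‖n p.2 z‖ₑ := by
            refine enorm_sub_le.trans (add_le_add ?_ le_rfl)
            refine (enorm_add_le _ _).trans (add_le_add ?_ le_rfl)
            refine (enorm_add_le _ _).trans (add_le_add ?_ t3)
            exact enorm_sub_le.trans (add_le_add t1 t2)
        _ = F z + D z := by
            rw [hF]
            ring
    calc _ ≤ ∫⁻ a in uIoc η ξ, ∫⁻ b in uIoc η a, (F (a, b) + D (a, b)) :=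
          lintegral_mono fun a => lintegral_mono fun b => hpt (a, b)
      _ = (∫⁻ a in uIoc η ξ, ∫⁻ b in uIoc η a, F (a, b)) +
            ∫⁻ a in uIoc η ξ, ∫⁻ b in uIoc η a, D (a, b) := by
          rw [← lintegral_add_right _ (measurable_lintegral_uIoc hDm η)]
          refine lintegral_congr fun a => ?_
          exact lintegral_add_right _ (hDm.comp measurable_prodMk_left)
      _ ≤ c p + L * ∫⁻ a in uIoc η ξ, ∫⁻ b in uIoc η a, ‖h p.1 (a, b) - h p.2 (a, b)‖ₑ := by
          refine add_le_add ((lintegral_characteristic_le hξη hFm).trans_eq hFc) (le_of_eq ?_)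
          rw [← lintegral_const_mul' _ _ ENNReal.coe_ne_top]
          refine lintegral_congr fun a => ?_
          exact lintegral_const_mul' _ _ ENNReal.coe_ne_top
  have hc1 : Tendsto (fun p => 2 * (c p).toReal * Real.exp ((L + 1) * (2 * R))) (l ×ˢ l)
      (𝓝 0) := by
    have := (((ENNReal.tendsto_toReal ENNReal.zero_ne_top).comp hc0).const_mul 2).mul_const
      (Real.exp ((L + 1) * (2 * R)))
    simpa using this
  intro U hU
  obtain ⟨δ, hδ, hδU⟩ := Metric.mem_uniformity_dist.1 hU
  filter_upwards [hmain, hc1.eventually_lt_const hδ] with p hp hpδ z hz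
  refine hδU ?_
  rw [dist_eq_norm]
  exact (hp z hz).trans_lt hpδ

end CauchyEstimate

/-! ### `L¹_loc` and locally uniform convergence in characteristic coordinates. -/

section LocalConvergence

variable {𝕜 : Type*} [RCLike 𝕜]

/-- The change to characteristic coordinates. -/
def charEquiv : (ℝ × ℝ) ≃L[ℝ] ℝ × ℝ :=
  LinearEquiv.toContinuousLinearEquiv
    { toFun := fun z => (z.1 + z.2, z.1 - z.2)
      invFun := fun z => charPoint z.1 z.2
      map_add' := fun z z' => by
        ext <;> simp <;> ring
      map_smul' := fun c z => by
        ext <;> simp <;> ring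
      left_inv := fun z => by
        ext <;> simp [charPoint]
      right_inv := fun z => by
        ext <;> simp [charPoint] <;> ring }

theorem charPoint_charEquiv (z : ℝ × ℝ) : charPoint (charEquiv z).1 (charEquiv z).2 = z :=
  charEquiv.symm_apply_apply z

/-- An invertible linear map scales Lebesgue measure by a constant; only its finiteness matters for
transferring limits equal to zero. -/
theorem exists_map_charEquiv :
    ∃ c : ENNReal, c ≠ ⊤ ∧ (volume : Measure (ℝ × ℝ)).map charEquiv = c • volume := by
  have h := Measure.map_linearMap_addHaar_eq_smul_addHaar (volume : Measure (ℝ × ℝ))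
    (f := (charEquiv.toLinearEquiv : ℝ × ℝ →ₗ[ℝ] ℝ × ℝ))
    (LinearEquiv.isUnit_det' charEquiv.toLinearEquiv).ne_zero
  exact ⟨_, ENNReal.ofReal_ne_top, h⟩

theorem exists_subset_charEquiv_preimage_square {K : Set (ℝ × ℝ)} (hK : IsCompact K) :
    ∃ R, K ⊆ charEquiv ⁻¹' square R := by
  obtain ⟨R, hR⟩ := (hK.image charEquiv.continuous).isBounded.subset_closedBall 0
  refine ⟨R, fun z hz => ?_⟩
  have h := hR (mem_image_of_mem _ hz)
  rw [mem_closedBall_zero_iff] at h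
  exact ⟨abs_le.1 ((norm_fst_le _).trans h), abs_le.1 ((norm_snd_le _).trans h)⟩

/-- Convergence in `L¹_loc` can be checked in characteristic coordinates. -/
theorem mem_locL1_of_characteristic {U : GenFun 𝕜 (⊤ : Opens (ℝ × ℝ))} {u : ℝ → ℝ × ℝ → 𝕜}
    (hu : IsRep u U) {w : ℝ × ℝ → 𝕜} (hw : AEStronglyMeasurable w volume)
    (h : ∀ R, Tendsto (fun ε => ∫⁻ z in square R, ‖u ε (charPoint z.1 z.2) - w z‖ₑ)
      (𝓝[>] 0) (𝓝 0)) : U ∈ locL1 𝕜 (⊤ : Opens (ℝ × ℝ)) := by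
  obtain ⟨c, hc, hmap⟩ := exists_map_charEquiv
  have hemb : MeasurableEmbedding charEquiv := charEquiv.toHomeomorph.measurableEmbedding
  have hlim : ∀ K : Set (ℝ × ℝ), IsCompact K →
      Tendsto (fun ε => ∫⁻ z in K, ‖u ε z - w (charEquiv z)‖ₑ) (𝓝[>] 0) (𝓝 0) := by
    intro K hK
    obtain ⟨R, hR⟩ := exists_subset_charEquiv_preimage_square hK
    have h1 := ENNReal.Tendsto.const_mul (h R) (Or.inr hc)
    rw [mul_zero] at h1
    refine tendsto_of_tendsto_of_tendsto_of_le_of_le tendsto_const_nhds h1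
      (fun _ => zero_le) fun ε => ?_
    calc ∫⁻ z in K, ‖u ε z - w (charEquiv z)‖ₑ
        ≤ ∫⁻ z in charEquiv ⁻¹' square R, ‖u ε z - w (charEquiv z)‖ₑ := lintegral_mono_set hR
      _ = ∫⁻ z in charEquiv ⁻¹' square R, ‖u ε (charPoint (charEquiv z).1 (charEquiv z).2) -
            w (charEquiv z)‖ₑ := by simp only [charPoint_charEquiv]
      _ = ∫⁻ z in square R, ‖u ε (charPoint z.1 z.2) - w z‖ₑ ∂(volume.map charEquiv) := by
          rw [hemb.restrict_map, hemb.lintegral_map]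
      _ = c * ∫⁻ z in square R, ‖u ε (charPoint z.1 z.2) - w z‖ₑ := by
          rw [hmap, Measure.restrict_smul, lintegral_smul_measure, smul_eq_mul]
  have hwm : AEStronglyMeasurable (fun z => w (charEquiv z)) volume := by
    refine hw.comp_quasiMeasurePreserving ⟨hemb.measurable, ?_⟩
    rw [hmap]
    exact Measure.smul_absolutelyContinuous
  refine ⟨u, fun z => w (charEquiv z), hu, ?_, fun K hK _ => hlim K hK⟩
  refine LocallyIntegrable.locallyIntegrableOn ?_ _
  rw [locallyIntegrable_iff]
  intro K hK
  -- Some continuous `u ε` is at finite `L¹` distance from the limit on `K`, so the limit is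
  -- integrable there.
  obtain ⟨ε, hε1, hε⟩ := (((hlim K hK).eventually_lt_const ENNReal.zero_lt_top).and
    eventually_Ioo).exists
  obtain ⟨hm, -⟩ := hu
  have hcu : Continuous (u ε) := (hm.1.contDiff ⟨hε.1, hε.2.le⟩).continuous
  have hiu : IntegrableOn (u ε) K := hcu.continuousOn.integrableOn_compact hK
  have hid : IntegrableOn (fun z => u ε z - w (charEquiv z)) K :=
    ⟨(hcu.aestronglyMeasurable.sub hwm).restrict, hε1⟩
  refine (hiu.sub hid).congr (ae_of_all _ fun z => ?_)
  simp

/-- Local `L¹` convergence of functions gives locally uniform convergence of their primitives. -/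
theorem enorm_primitive_sub_le {b β : ℝ → 𝕜} (hb : Continuous b) (hβ : LocallyIntegrable β)
    {R x : ℝ} (hx : x ∈ Icc (-R) R) :
    ‖(∫ y in 0..x, b y) - ∫ y in 0..x, β y‖ₑ ≤ ∫⁻ y in Icc (-R) R, ‖b y - β y‖ₑ := by
  rw [← intervalIntegral.integral_sub (hb.intervalIntegrable _ _) (hβ.integrableOn_isCompact isCompact_uIcc).intervalIntegrable]
  refine (enorm_intervalIntegral_le _ _ _).trans (lintegral_mono_set ?_)
  refine uIoc_subset_uIcc.trans (uIcc_subset_Icc ⟨?_, ?_⟩ hx) <;> linarith [hx.1, hx.2]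

/-- `L¹` convergence of one-dimensional free profiles. -/
theorem tendsto_lintegral_profile {a b : ℝ → ℝ → 𝕜} (hb : IsSmoothFamily (⊤ : Opens ℝ) b)
    {α β : ℝ → 𝕜} (hβ : LocallyIntegrable β) {R : ℝ}
    (ha : Tendsto (fun ε => ∫⁻ x in Icc (-R) R, ‖a ε x - α x‖ₑ) (𝓝[>] 0) (𝓝 0))
    (hbβ : Tendsto (fun ε => ∫⁻ x in Icc (-R) R, ‖b ε x - β x‖ₑ) (𝓝[>] 0) (𝓝 0)) (c : 𝕜)
    (hc : ‖c‖ₑ ≤ 1) :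
    Tendsto (fun ε => ∫⁻ x in Icc (-R) R,
      ‖2⁻¹ * (a ε x + c * primitive b ε x) - 2⁻¹ * (α x + c * ∫ y in 0..x, β y)‖ₑ)
      (𝓝[>] 0) (𝓝 0) := by
  have hv : volume (Icc (-R) R) ≠ ⊤ := isCompact_Icc.measure_ne_top
  -- The error is at most that of `a` plus the interval length times that of `b`. The left- and
  -- right-moving profiles correspond to `c = 1` and `c = -1`.
  have h1 := ha.add (ENNReal.Tendsto.mul_const hbβ (Or.inr hv))
  rw [zero_mul, add_zero] at h1
  refine tendsto_of_tendsto_of_tendsto_of_le_of_le' tendsto_const_nhds h1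
    (Eventually.of_forall fun _ => zero_le) ?_
  filter_upwards [eventually_Ioo] with ε hε
  have hcb := (hb.contDiff ⟨hε.1, hε.2.le⟩).continuous
  rw [← setLIntegral_const, ← lintegral_add_right _ measurable_const]
  refine setLIntegral_mono' measurableSet_Icc fun x hx => ?_
  have h2 : ‖(2⁻¹ : 𝕜)‖ₑ ≤ 1 := by
    rw [← ofReal_norm, ← ENNReal.ofReal_one]
    refine ENNReal.ofReal_le_ofReal ?_
    rw [norm_inv, RCLike.norm_ofNat]
    norm_num
  rw [show 2⁻¹ * (a ε x + c * primitive b ε x) - 2⁻¹ * (α x + c * ∫ y in 0..x, β y) =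
    2⁻¹ * ((a ε x - α x) + c * (primitive b ε x - ∫ y in 0..x, β y)) by ring, enorm_mul]
  refine (mul_le_of_le_one_left zero_le h2).trans ((enorm_add_le _ _).trans ?_)
  refine add_le_add le_rfl ?_
  rw [enorm_mul]
  exact (mul_le_of_le_one_left zero_le hc).trans (enorm_primitive_sub_le hcb hβ hx)

theorem aestronglyMeasurable_profile {α β : ℝ → 𝕜} (hα : LocallyIntegrable α)
    (hβ : LocallyIntegrable β) (c : 𝕜) :
    AEStronglyMeasurable (fun x => 2⁻¹ * (α x + c * ∫ y in 0..x, β y)) volume := by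
  have h : Continuous fun x => ∫ y in 0..x, β y :=
    intervalIntegral.continuous_primitive (fun _ _ =>
      (hβ.integrableOn_isCompact isCompact_uIcc).intervalIntegrable) 0
  exact (hα.aestronglyMeasurable.add (h.aestronglyMeasurable.const_mul c)).const_mul _

/-- `L¹` convergence on squares of sums of functions of one variable. -/
theorem tendsto_lintegral_square_add {ι : Type*} {l : Filter ι} {p q : ι → ℝ → 𝕜} {P Q : ℝ → 𝕜}
    {R : ℝ} (hp : ∀ᶠ i in l, AEStronglyMeasurable (p i) volume)
    (hq : ∀ᶠ i in l, AEStronglyMeasurable (q i) volume)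
    (hP : AEStronglyMeasurable P volume) (hQ : AEStronglyMeasurable Q volume)
    (hpP : Tendsto (fun i => ∫⁻ x in Icc (-R) R, ‖p i x - P x‖ₑ) l (𝓝 0))
    (hqQ : Tendsto (fun i => ∫⁻ x in Icc (-R) R, ‖q i x - Q x‖ₑ) l (𝓝 0)) :
    Tendsto (fun i => ∫⁻ z in square R, ‖p i z.1 + q i z.2 - (P z.1 + Q z.2)‖ₑ) l (𝓝 0) := by
  have hv : volume (Icc (-R) R) ≠ ⊤ := isCompact_Icc.measure_ne_top
  -- By Tonelli, each one-variable error is multiplied by the length of the other side of the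
  -- square.
  have h1 := (ENNReal.Tendsto.mul_const hpP (Or.inr hv)).add
    (ENNReal.Tendsto.const_mul hqQ (Or.inr hv))
  rw [zero_mul, mul_zero, add_zero] at h1
  refine tendsto_of_tendsto_of_tendsto_of_le_of_le' tendsto_const_nhds h1
    (Eventually.of_forall fun _ => zero_le) ?_
  filter_upwards [hp, hq] with i hpi hqi
  have hR : (volume.restrict (square R) : Measure (ℝ × ℝ)) =
      (volume.restrict (Icc (-R) R)).prod (volume.restrict (Icc (-R) R)) :=
    (Measure.prod_restrict _ _).symm
  have m1 : AEMeasurable (fun x => ‖p i x - P x‖ₑ) (volume.restrict (Icc (-R) R)) :=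
    (hpi.sub hP).restrict.enorm
  have m2 : AEMeasurable (fun x => ‖q i x - Q x‖ₑ) (volume.restrict (Icc (-R) R)) :=
    (hqi.sub hQ).restrict.enorm
  have e1 := lintegral_prod_mul m1 (aemeasurable_const (b := (1 : ENNReal))
    (μ := volume.restrict (Icc (-R) R)))
  have e2 := lintegral_prod_mul (aemeasurable_const (b := (1 : ENNReal))
    (μ := volume.restrict (Icc (-R) R))) m2
  simp only [mul_one, one_mul, lintegral_one, Measure.restrict_apply_univ] at e1 e2
  rw [hR, ← e1, ← e2, ← lintegral_add_left' m1.comp_fst]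
  refine lintegral_mono fun z => ?_
  rw [show p i z.1 + q i z.2 - (P z.1 + Q z.2) = (p i z.1 - P z.1) + (q i z.2 - Q z.2) by ring]
  exact enorm_add_le _ _

/-- Locally uniform Cauchy families of continuous functions have a continuous limit. -/
theorem exists_continuous_limit {h : ℝ → ℝ × ℝ → 𝕜} (hc : ∀ᶠ ε in 𝓝[>] 0, Continuous (h ε))
    (hC : ∀ R, UniformCauchySeqOn h (𝓝[>] 0) (square R)) :
    ∃ H : ℝ × ℝ → 𝕜, Continuous H ∧ ∀ R, TendstoUniformlyOn h H (𝓝[>] 0) (square R) := by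
  have hmem : ∀ z : ℝ × ℝ, ∀ R, ‖z‖ ≤ R → z ∈ square R := fun z R hz =>
    ⟨abs_le.1 ((norm_fst_le z).trans hz), abs_le.1 ((norm_snd_le z).trans hz)⟩
  have hex : ∀ z, ∃ y, Tendsto (fun ε => h ε z) (𝓝[>] 0) (𝓝 y) := fun z =>
    cauchy_map_iff_exists_tendsto.1 ((hC ‖z‖).cauchy_map (hmem z _ le_rfl))
  choose H hH using hex
  have hU : ∀ R, TendstoUniformlyOn h H (𝓝[>] 0) (square R) := fun R =>
    (hC R).tendstoUniformlyOn_of_tendsto fun z _ => hH z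
  refine ⟨H, ?_, hU⟩
  refine TendstoLocallyUniformly.continuous (F := h) (p := 𝓝[>] 0) ?_ hc.frequently
  intro V hV z
  refine ⟨square (‖z‖ + 1), ?_, hU (‖z‖ + 1) V hV⟩
  filter_upwards [Metric.ball_mem_nhds z one_pos] with y hy
  refine hmem y _ ?_
  have h1 := norm_le_norm_add_norm_sub' y z
  rw [mem_ball_iff_norm] at hy
  linarith

end LocalConvergence

/-! ### Decomposition of the solution. -/

section MainTheorem

variable {𝕜 : Type*} [RCLike 𝕜]

/-- Negligible differences are `O(ε)`. Thus the asymptotic conditions on `M`, given for some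
representative, pass to the half integrals of `b`. -/
theorem IsNumRep.tendsto_sub {r r' : ℝ → 𝕜} {M : GenNum 𝕜} (h : IsNumRep r M)
    (h' : IsNumRep r' M) : Tendsto (fun ε => r ε - r' ε) (𝓝[>] 0) (𝓝 0) := by
  obtain ⟨hr, rfl⟩ := h
  obtain ⟨hr', h⟩ := h'
  have h1 := Ideal.Quotient.eq.1 h.symm 1 zero_le_one
  refine h1.trans_tendsto ?_
  have h2 : Tendsto (fun ε : ℝ => ε) (𝓝[>] 0) (𝓝 0) := tendsto_id'.2 nhdsWithin_le_nhds
  simpa using h2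

theorem primitive_sub_apply {a b : ℝ → ℝ → 𝕜} (ha : IsSmoothFamily (⊤ : Opens ℝ) a)
    (hb : IsSmoothFamily (⊤ : Opens ℝ) b) {ε : ℝ} (hε : ε ∈ Ioc (0 : ℝ) 1) (x : ℝ) :
    primitive (a - b) ε x = primitive a ε x - primitive b ε x :=
  intervalIntegral.integral_sub ((ha.contDiff hε).continuous.intervalIntegrable _ _)
    ((hb.contDiff hε).continuous.intervalIntegrable _ _)

/-- The free wave in characteristic coordinates. -/
def charWave (a b : ℝ → ℝ → 𝕜) : ℝ → ℝ × ℝ → 𝕜 :=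
  fun ε z => leftMoving a b ε z.1 + rightMoving a b ε z.2

theorem freeWave_charPoint (a b : ℝ → ℝ → 𝕜) (ε : ℝ) (z : ℝ × ℝ) :
    freeWave a b ε (charPoint z.1 z.2) = charWave a b ε z := by
  have h1 : (z.1 + z.2) / 2 + (z.1 - z.2) / 2 = z.1 := by ring
  have h2 : (z.1 + z.2) / 2 - (z.1 - z.2) / 2 = z.2 := by ring
  simp only [freeWave, charWave, charPoint, h1, h2]

theorem charWave_sub_apply {a b a' b' : ℝ → ℝ → 𝕜} (hb : IsSmoothFamily (⊤ : Opens ℝ) b)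
    (hb' : IsSmoothFamily (⊤ : Opens ℝ) b') {ε : ℝ} (hε : ε ∈ Ioc (0 : ℝ) 1) (z : ℝ × ℝ) :
    charWave (a - a') (b - b') ε z = charWave a b ε z - charWave a' b' ε z := by
  simp only [charWave, leftMoving, rightMoving, Pi.smul_apply, Pi.add_apply, Pi.sub_apply,
    primitive_sub_apply hb hb' hε, smul_eq_mul]
  ring

theorem IsModerate.continuous {E : Type*} [NormedAddCommGroup E] [NormedSpace ℝ E]
    {u : ℝ → E → 𝕜} (hu : IsModerate (⊤ : Opens E) u) {ε : ℝ} (hε : ε ∈ Ioc (0 : ℝ) 1) :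
    Continuous (u ε) :=
  (hu.1.contDiff hε).continuous

theorem continuous_charWave {a b : ℝ → ℝ → 𝕜} (ha : IsModerate (⊤ : Opens ℝ) a)
    (hb : IsModerate (⊤ : Opens ℝ) b) {ε : ℝ} (hε : ε ∈ Ioc (0 : ℝ) 1) :
    Continuous (charWave a b ε) :=
  (((ha.leftMoving hb).continuous hε).comp continuous_fst).add
    (((ha.rightMoving hb).continuous hε).comp continuous_snd)

/-- Free waves with initial data converging in `L¹_loc` converge in `L¹_loc`. -/
theorem exists_limit_charWave {a b : ℝ → ℝ → 𝕜} (ha : IsModerate (⊤ : Opens ℝ) a)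
    (hb : IsModerate (⊤ : Opens ℝ) b) {α β : ℝ → 𝕜} (hα : LocallyIntegrable α)
    (hβ : LocallyIntegrable β)
    (haα : ∀ R : ℝ, Tendsto (fun ε => ∫⁻ x in Icc (-R) R, ‖a ε x - α x‖ₑ) (𝓝[>] 0) (𝓝 0))
    (hbβ : ∀ R : ℝ, Tendsto (fun ε => ∫⁻ x in Icc (-R) R, ‖b ε x - β x‖ₑ) (𝓝[>] 0) (𝓝 0)) :
    ∃ w : ℝ × ℝ → 𝕜, AEStronglyMeasurable w volume ∧ ∀ R, Tendsto
      (fun ε => ∫⁻ z in square R, ‖charWave a b ε z - w z‖ₑ) (𝓝[>] 0) (𝓝 0) := by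
  have mP := aestronglyMeasurable_profile hα hβ 1
  have mQ := aestronglyMeasurable_profile hα hβ (-1)
  set P : ℝ → 𝕜 := fun x => 2⁻¹ * (α x + 1 * ∫ y in 0..x, β y) with hP
  set Q : ℝ → 𝕜 := fun x => 2⁻¹ * (α x + -1 * ∫ y in 0..x, β y) with hQ
  have hl : ∀ ε x, leftMoving a b ε x = 2⁻¹ * (a ε x + 1 * primitive b ε x) := fun ε x => by
    simp [leftMoving]
  have hr : ∀ ε x, rightMoving a b ε x = 2⁻¹ * (a ε x + -1 * primitive b ε x) := fun ε x => by
    simp [rightMoving, sub_eq_add_neg]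
  refine ⟨fun z => P z.1 + Q z.2, mP.comp_fst.add mQ.comp_snd, fun R => ?_⟩
  have h1 : Tendsto (fun ε => ∫⁻ x in Icc (-R) R, ‖leftMoving a b ε x - P x‖ₑ)
      (𝓝[>] 0) (𝓝 0) := by
    simp only [hl, hP]
    exact tendsto_lintegral_profile hb.1 hβ (haα R) (hbβ R) 1 (by simp)
  have h2 : Tendsto (fun ε => ∫⁻ x in Icc (-R) R, ‖rightMoving a b ε x - Q x‖ₑ)
      (𝓝[>] 0) (𝓝 0) := by
    simp only [hr, hQ]
    exact tendsto_lintegral_profile hb.1 hβ (haα R) (hbβ R) (-1) (by simp)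
  refine tendsto_lintegral_square_add ?_ ?_ mP mQ h1 h2
  · filter_upwards [eventually_Ioo] with ε hε
    exact ((ha.leftMoving hb).continuous ⟨hε.1, hε.2.le⟩).aestronglyMeasurable
  · filter_upwards [eventually_Ioo] with ε hε
    exact ((ha.rightMoving hb).continuous ⟨hε.1, hε.2.le⟩).aestronglyMeasurable

/-- Off the light cone, the singular free wave converges or is infinitely large. -/
theorem tendsto_charWave_or {f : 𝕜 → 𝕜} {a b : ℝ → ℝ → 𝕜} (hb : IsSmoothFamily (⊤ : Opens ℝ) b)
    (ha0 : NullOffZero a) (hb0 : NullOffZero b) {R : ℝ}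
    (hR : ∀ ε ∈ Ioc (0 : ℝ) 1, ∀ x, R < |x| → b ε x = 0) {M : GenNum 𝕜}
    (hM : IsNumRep (fun ε => (1 / 2 : 𝕜) * ∫ x, b ε x) M)
    (h : (∃ m, M.AssociatedTo m) ∨
      (∃ c, Tendsto f (comap norm atTop) (𝓝 c)) ∧ M.AbsInfinite) :
    ∀ᵐ z : ℝ × ℝ, (∃ c, Tendsto (fun ε => charWave a b ε z) (𝓝[>] 0) (𝓝 c)) ∨
      (Tendsto (fun ε => ‖charWave a b ε z‖) (𝓝[>] 0) atTop ∧
        ∃ c, Tendsto f (comap norm atTop) (𝓝 c)) := by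
  -- In characteristic coordinates the light cone is the union of the two axes, a null set.
  have hne : ∀ᵐ x : ℝ, x ≠ 0 := Measure.ae_ne volume 0
  have h1 : ∀ᵐ z : ℝ × ℝ, z.1 ≠ 0 := Measure.quasiMeasurePreserving_fst.ae hne
  have h2 : ∀ᵐ z : ℝ × ℝ, z.2 ≠ 0 := Measure.quasiMeasurePreserving_snd.ae hne
  filter_upwards [h1, h2] with z hz1 hz2
  obtain ⟨κ, hκ, hlim⟩ := exists_tendsto_freeWave_sub hb ha0 hb0 hR hz1 hz2
  rcases h with ⟨m, r, hr, hrm⟩ | ⟨hf, r, hr, hrM⟩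
  · left
    have h3 := hlim.add (((hM.tendsto_sub hr).add hrm).const_mul κ)
    exact ⟨_, h3.congr fun ε => by simp only [charWave]; ring⟩
  -- Even for infinitely large `M` the singular wave tends to zero outside the cone, where `κ = 0`;
  -- inside, its size is that of `M` up to a vanishing error.
  · rcases hκ with rfl | hκ
    · left
      exact ⟨0, hlim.congr fun ε => by simp only [charWave]; ring⟩
    · right
      refine ⟨?_, hf⟩
      have h3 := (hlim.add ((hM.tendsto_sub hr).const_mul κ)).norm
      rw [mul_zero, add_zero, norm_zero] at h3
      refine tendsto_atTop_mono (fun ε => ?_) (hrM.atTop_add h3.neg)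
      have h4 := norm_sub_le (charWave a b ε z) (charWave a b ε z - κ * r ε)
      rw [sub_sub_cancel, norm_mul, hκ, one_mul] at h4
      have h5 : leftMoving a b ε z.1 + rightMoving a b ε z.2 - κ * ((1 / 2 : 𝕜) * ∫ x, b ε x) +
          κ * ((1 / 2 : 𝕜) * (∫ x, b ε x) - r ε) = charWave a b ε z - κ * r ε := by
        simp only [charWave]
        ring
      rw [h5]
      linarith

/-- A representative of a solution satisfies the equation up to a null family. -/
theorem IsWaveSolution.isNull {f : 𝕜 → 𝕜} {hf : SlowGrowth f} {u₀ u₁ : GenFun 𝕜 (⊤ : Opens ℝ)}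
    {U : GenFun 𝕜 (⊤ : Opens (ℝ × ℝ))} (hU : IsWaveSolution f hf u₀ u₁ U) {u : ℝ → ℝ × ℝ → 𝕜}
    (hu : IsRep u U) :
    IsNull (⊤ : Opens (ℝ × ℝ)) (dirDeriv (0, 1) (dirDeriv (0, 1) u) -
      dirDeriv (1, 0) (dirDeriv (1, 0) u) - fun ε z => f (u ε z)) := by
  obtain ⟨hm, rfl⟩ := hu
  exact (GenFun.mk_eq_mk (((hm.dirDeriv _).dirDeriv _).sub ((hm.dirDeriv _).dirDeriv _))
    (hm.superpose hf)).1 hU.equation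

theorem IsWaveSolution.isRep_initial {f : 𝕜 → 𝕜} {hf : SlowGrowth f}
    {u₀ u₁ : GenFun 𝕜 (⊤ : Opens ℝ)}
    {U : GenFun 𝕜 (⊤ : Opens (ℝ × ℝ))} (hU : IsWaveSolution f hf u₀ u₁ U) {u : ℝ → ℝ × ℝ → 𝕜}
    (hu : IsRep u U) : IsRep (fun ε x => u ε (x, 0)) u₀ ∧
      IsRep (fun ε x => fderiv ℝ (u ε) (x, 0) (0, 1)) u₁ := by
  obtain ⟨hm, rfl⟩ := hu
  exact ⟨⟨hm.comp_right (ContinuousLinearMap.inl ℝ ℝ ℝ), hU.initial⟩,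
    ⟨(hm.dirDeriv (0, 1)).comp_right (ContinuousLinearMap.inl ℝ ℝ ℝ), hU.initial_deriv⟩⟩

/-- The solution is the sum of a free wave, regular off the light cone, and a part converging in
`L¹_loc`. -/
theorem exists_regular_add_locL1
    (f : 𝕜 → 𝕜) (hf : SlowGrowth f) (hLip : ∃ C : NNReal, LipschitzWith C f)
    (r₀ r₁ s₀ s₁ : GenFun 𝕜 (⊤ : Opens ℝ))
    (hr₀ : r₀ ∈ locL1 𝕜 (⊤ : Opens ℝ))
    (hr₁ : r₁ ∈ locL1 𝕜 (⊤ : Opens ℝ))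
    (hs₀ : s₀.support ⊆ {0}) (hs₁ : s₁.support ⊆ {0})
    (M : GenNum 𝕜) (hM : IsHalfIntegral s₁ M)
    (u : GenFun 𝕜 (⊤ : Opens (ℝ × ℝ)))
    (hu : IsWaveSolution f hf (r₀ + s₀) (r₁ + s₁) u)
    (h : ((∃ B : ℝ, ∀ y, ‖f y‖ ≤ B) ∧ ∃ m : 𝕜, M.AssociatedTo m) ∨
      ((∃ B : ℝ, ∀ y, ‖f y‖ ≤ B) ∧
        (∃ L : 𝕜, Tendsto f (comap norm atTop) (𝓝 L)) ∧
        M.AbsInfinite)) :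
    ∃ g l : GenFun 𝕜 (⊤ : Opens (ℝ × ℝ)),
      u = g + l ∧
      g.restrict (le_top : offLightCone ≤ ⊤) ∈
        regular 𝕜 offLightCone ∧
      l ∈ locL1 𝕜 (⊤ : Opens (ℝ × ℝ)) := by
  obtain ⟨L, hL⟩ := hLip
  obtain ⟨⟨B, hB⟩, hMf⟩ : (∃ B : ℝ, ∀ y, ‖f y‖ ≤ B) ∧ ((∃ m, M.AssociatedTo m) ∨
      (∃ c, Tendsto f (comap norm atTop) (𝓝 c)) ∧ M.AbsInfinite) := by
    rcases h with ⟨hB, hm⟩ | ⟨hB, hc⟩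
    · exact ⟨hB, Or.inl hm⟩
    · exact ⟨hB, Or.inr hc⟩
  obtain ⟨v, hv⟩ := u.exists_isRep
  obtain ⟨a, ha⟩ := s₀.exists_isRep
  obtain ⟨b, R₀, hb, hbR, hbM⟩ := hM
  obtain ⟨hv₀, hv₁⟩ := hu.isRep_initial hv
  have hn := hu.isNull hv
  set v₀ : ℝ → ℝ → 𝕜 := fun ε x => v ε (x, 0) with hv₀def
  set v₁ : ℝ → ℝ → 𝕜 := fun ε x => fderiv ℝ (v ε) (x, 0) (0, 1) with hv₁def
  -- Taking the regular data from `v` itself makes the initial data split exactly, so a null error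
  -- remains only in the equation.
  have hp : IsRep (v₀ - a) r₀ := by simpa using hv₀.sub ha
  have hq : IsRep (v₁ - b) r₁ := by simpa using hv₁.sub hb
  obtain ⟨α, hα, hα'⟩ := exists_limit_of_mem_locL1 hr₀
  obtain ⟨β, hβ, hβ'⟩ := exists_limit_of_mem_locL1 hr₁
  have ha0 := ha.nullOffZero hs₀
  have hb0 := hb.nullOffZero hs₁
  have hpα := hα' _ hp
  have hqβ := hβ' _ hq
  obtain ⟨hvm, -⟩ := id hv
  obtain ⟨ham, -⟩ := id ha
  obtain ⟨hbm, -⟩ := id hb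
  obtain ⟨hv₁m, -⟩ := id hv₁
  obtain ⟨hpm, -⟩ := id hp
  obtain ⟨hqm, -⟩ := id hq
  have hgm := ham.freeWave hbm
  refine ⟨GenFun.mk (freeWave a b) hgm, u - GenFun.mk (freeWave a b) hgm,
    (add_sub_cancel _ _).symm,
    ⟨freeWave a b, ⟨hgm.mono le_top, rfl⟩, isRegularFamily_freeWave ham hbm ha0 hb0⟩, ?_⟩
  obtain ⟨w, hwm, hw⟩ := exists_limit_charWave hpm hqm hα hβ hpα hqβ
  set N : ℝ → ℝ × ℝ → 𝕜 := dirDeriv (0, 1) (dirDeriv (0, 1) v) -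
    dirDeriv (1, 0) (dirDeriv (1, 0) v) - fun ε z => f (v ε z) with hN
  -- `k` is the Duhamel part of `v`: what is left after both free waves have been removed.
  set k : ℝ → ℝ × ℝ → 𝕜 := fun ε z => v ε (charPoint z.1 z.2) -
    charWave (v₀ - a) (v₁ - b) ε z - charWave a b ε z with hk
  have hcont : ∀ᶠ ε in 𝓝[>] (0 : ℝ), Continuous (charWave (v₀ - a) (v₁ - b) ε) ∧
      Continuous (charWave a b ε) ∧ Continuous (fun z : ℝ × ℝ => N ε (charPoint z.1 z.2)) ∧
      Continuous (k ε) := by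
    filter_upwards [eventually_Ioo] with ε hε
    have hε' : ε ∈ Ioc (0 : ℝ) 1 := ⟨hε.1, hε.2.le⟩
    have h1 := continuous_charWave hpm hqm hε'
    have h2 := continuous_charWave ham hbm hε'
    exact ⟨h1, h2, (hn.isModerate.continuous hε').comp continuous_charPoint,
      (((hvm.continuous hε').comp continuous_charPoint).sub h1).sub h2⟩
  have hNu : ∀ R, TendstoUniformlyOn (fun ε (z : ℝ × ℝ) => N ε (charPoint z.1 z.2)) 0 (𝓝[>] 0)
      (square R) := fun R =>
    ((hn.tendstoUniformlyOn ((isCompact_square R).image continuous_charPoint)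
      (fun _ _ => trivial)).comp (fun z : ℝ × ℝ => charPoint z.1 z.2)).mono
      (subset_preimage_image _ _)
  have heq : ∀ᶠ ε in 𝓝[>] (0 : ℝ), ∀ ξ η, k ε (ξ, η) = 4⁻¹ * ∫ x in η..ξ, ∫ y in η..x,
      (f (charWave (v₀ - a) (v₁ - b) ε (x, y) + charWave a b ε (x, y) + k ε (x, y)) +
        N ε (charPoint x y)) := by
    filter_upwards [eventually_Ioo] with ε hε ξ η
    have hε' : ε ∈ Ioc (0 : ℝ) 1 := ⟨hε.1, hε.2.le⟩
    have e1 : ∀ x y, f (charWave (v₀ - a) (v₁ - b) ε (x, y) + charWave a b ε (x, y) +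
        k ε (x, y)) + N ε (charPoint x y) =
        fderiv ℝ (fun z => fderiv ℝ (v ε) z (0, 1)) (charPoint x y) (0, 1) -
          fderiv ℝ (fun z => fderiv ℝ (v ε) z (1, 0)) (charPoint x y) (1, 0) := fun x y => by
      rw [show charWave (v₀ - a) (v₁ - b) ε (x, y) + charWave a b ε (x, y) + k ε (x, y) =
        v ε (charPoint x y) by simp only [hk]; ring]
      exact add_sub_cancel _ _
    simp only [e1]
    have e2 := characteristic_formula (hvm.1.contDiff hε') ξ η
    have e3 : k ε (ξ, η) = v ε (charPoint ξ η) - charWave v₀ v₁ ε (ξ, η) := by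
      simp only [hk, charWave_sub_apply hv₁m.1 hbm.1 hε']
      ring
    rw [e3, e2]
    simp only [charWave, leftMoving, rightMoving, Pi.smul_apply, Pi.add_apply, Pi.sub_apply,
      smul_eq_mul, primitive, hv₀def, hv₁def]
    ring
  have hCauchy : ∀ R, UniformCauchySeqOn k (𝓝[>] 0) (square R) := fun R =>
    uniformCauchySeqOn_of_integral_equation hL hB hcont hwm.restrict (hw R)
      (tendsto_charWave_or hbm.1 ha0 hb0 hbR hbM hMf) (hNu R) heq
  obtain ⟨H, hH, hkH⟩ := exists_continuous_limit (hcont.mono fun ε h => h.2.2.2) hCauchy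
  -- The limit of `v - g` is the `L¹` limit `w` of the regular free wave plus the continuous limit
  -- `H` of the Duhamel part.
  refine mem_locL1_of_characteristic (hv.sub ⟨hgm, rfl⟩) (hwm.add hH.aestronglyMeasurable)
    fun R => ?_
  have hlim := (hw R).add (tendsto_setLIntegral_enorm_of_tendstoUniformlyOn (μ := volume)
    (isCompact_square R).measure_ne_top (hkH R) (measurableSet_Icc.prod measurableSet_Icc))
  rw [add_zero] at hlim
  refine tendsto_of_tendsto_of_tendsto_of_le_of_le' tendsto_const_nhds hlim
    (Eventually.of_forall fun _ => zero_le) ?_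
  filter_upwards [hcont] with ε hε
  rw [← lintegral_add_right _ (hε.2.2.2.fun_sub hH).enorm.measurable]
  refine lintegral_mono fun z => ?_
  have e : (v - freeWave a b) ε (charPoint z.1 z.2) - (w + H) z =
      (charWave (v₀ - a) (v₁ - b) ε z - w z) + (k ε z - H z) := by
    simp only [Pi.sub_apply, Pi.add_apply, freeWave_charPoint, hk]
    ring
  rw [e]
  exact enorm_add_le _ _

end MainTheorem

end

end Colombeau

theorem mainTheorem1 {𝕜 : Type*} [RCLike 𝕜]
    (f : 𝕜 → 𝕜) (hf : Colombeau.SlowGrowth f) (hLip : ∃ C : NNReal, LipschitzWith C f)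
    (r₀ r₁ s₀ s₁ : Colombeau.GenFun 𝕜 (⊤ : TopologicalSpace.Opens ℝ))
    (hr₀ : r₀ ∈ Colombeau.locL1 𝕜 (⊤ : TopologicalSpace.Opens ℝ))
    (hr₁ : r₁ ∈ Colombeau.locL1 𝕜 (⊤ : TopologicalSpace.Opens ℝ))
    (hs₀ : s₀.support ⊆ {0}) (hs₁ : s₁.support ⊆ {0})
    (M : Colombeau.GenNum 𝕜) (hM : Colombeau.IsHalfIntegral s₁ M)
    (u : Colombeau.GenFun 𝕜 (⊤ : TopologicalSpace.Opens (ℝ × ℝ)))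
    (hu : Colombeau.IsWaveSolution f hf (r₀ + s₀) (r₁ + s₁) u)
    (h : ((∃ B : ℝ, ∀ y, ‖f y‖ ≤ B) ∧ ∃ m : 𝕜, M.AssociatedTo m) ∨
      ((∃ B : ℝ, ∀ y, ‖f y‖ ≤ B) ∧
        (∃ L : 𝕜, Filter.Tendsto f (Filter.comap norm Filter.atTop) (nhds L)) ∧
        M.AbsInfinite)) :
    ∃ g l : Colombeau.GenFun 𝕜 (⊤ : TopologicalSpace.Opens (ℝ × ℝ)),
      u = g + l ∧
      g.restrict (le_top : Colombeau.offLightCone ≤ ⊤) ∈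
        Colombeau.regular 𝕜 Colombeau.offLightCone ∧
      l ∈ Colombeau.locL1 𝕜 (⊤ : TopologicalSpace.Opens (ℝ × ℝ)) := by
  exact Colombeau.exists_regular_add_locL1 f hf hLip r₀ r₁ s₀ s₁ hr₀ hr₁ hs₀ hs₁ M hM u hu h
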